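/- \textbf{Notation.} Let $\partial = d/dz$, let $\mathbb{C}(z)[\partial]$ be the algebra of differential operators with rational coefficients (acting on $\mathbb{C}(z)$, written $D.f$), and let $A_1 = \mathbb{C}[z,\partial]$ be the Weyl algebra, with generators $x=\partial$, $y=z$ and $[x,y]=1$. Let $Q \supset \mathbb{C}(z)[\partial]$ be the quotient skew field of $A_1$. Let $c$ be the anti-automorphism of $A_1$ with $c(x)=-x$, $c(y)=y$ (the formal adjoint); it extends uniquely to an anti-automorphism $c$ of $Q$, which on $\mathbb{C}(z)[\partial]$ is $\sum_i a_i\partial^i \mapsto \sum_i(-\partial)^i a_i$. Let $\mathcal{R}$ be the set of isomorphism classes (as right $A_1$-modules) of non-zero right ideals of $A_1$. The anti-automorphism $c$ acts on $\mathcal{R}$ by sending the class of $I$ to the class of the dual $c(I)' = \{q\in Q : c(I)\,q\subset A_1\}$ of the left ideal $c(I)$, where the class of a non-zero fractional right ideal $F \subset Q$ means the class of all right ideals of $A_1$ isomorphic to $F$. We write $c\star C$ for the image of $C\in\mathcal{R}$. A linear subspace $V\subset\mathbb{C}[z]$ is $\lambda$-primary ($\lambda\in\mathbb{C}$) if $(z-\lambda)^r\mathbb{C}[z]\subset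 V$ for some $r\ge 0$. The adelic Grassmannian $\mathrm{Gr}^{\mathrm{ad}}$ is the set of all linear subspaces of $\mathbb{C}(z)$ of the form $$W=\Big(\prod_{\lambda\in S}(z-\lambda)^{k_\lambda}\Big)^{-1}\bigcap_{\lambda\in S}V_\lambda ,\qquad k_\lambda=\dim\,\mathbb{C}[z]/V_\lambda,$$ where $S\subset\mathbb{C}$ is finite and $V_\lambda$ is $\lambda$-primary for each $\lambda\in S$ (for $S=\emptyset$ this is $W=\mathbb{C}[z]$). For $W\in\mathrm{Gr}^{\mathrm{ad}}$ put $$R_W=\{D\in\mathbb{C}(z)[\partial] : D.\mathbb{C}[z]\subset W\},\qquad L_W=\{D\in\mathbb{C}(z)[\partial] : D.W\subset\mathbb{C}[z]\},$$ and let $\alpha(W)$ be the isomorphism class of the fractional right ideal $R_W$. Let $$W^*=\{f\in\mathbb{C}(z) : \mathrm{res}_\infty\, f(z)g(z)\,dz=0\ \text{ for all } g\in W\}$$ be the annihilator of $W$ under the residue pairing. \textbf{Proposition.} Let $W\in\mathrm{Gr}^{\mathrm{ad}}$. Then $W^*\in\mathrm{Gr}^{\mathrm{ad}}$ and $R_{W^*}=c(L_W)$.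 Moreover $\alpha(W)\in\mathcal{R}$, and under $\alpha$ the action of $c$ on $\mathcal{R}$ corresponds to $W\mapsto W^*$ on $\mathrm{Gr}^{\mathrm{ad}}$: for every $U\in\mathrm{Gr}^{\mathrm{ad}}$, $$\alpha(U)=c\star\alpha(W)\iff U=W^*.$$ -/

import Mathlib

open Polynomial

noncomputable section

namespace AdelicGr

/-! ### The field `ℂ(z)` and the derivation `∂ = d/dz` -/

/-- The field `ℂ(z)` of rational functions. -/
abbrev Kz : Type := RatFunc ℂ

/-- The inclusion `ℂ[z] ⊆ ℂ(z)`. -/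
abbrev polyIncl : ℂ[X] →ₐ[ℂ] Kz := IsScalarTower.toAlgHom ℂ ℂ[X] Kz

/-- The derivative of a rational function, by the quotient rule. -/
def ratDeriv (f : Kz) : Kz :=
  (polyIncl (derivative f.num) * polyIncl f.denom - polyIncl f.num * polyIncl (derivative f.denom)) /
    polyIncl f.denom ^ 2

lemma polyIncl_ne_zero {p : ℂ[X]} (hp : p ≠ 0) : polyIncl p ≠ 0 := by
  simpa using hp

lemma num_div (f : Kz) : polyIncl f.num / polyIncl f.denom = f := RatFunc.num_div_denom f

lemma ratDeriv_div (p q : ℂ[X]) (hq : q ≠ 0) :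
    ratDeriv (polyIncl p / polyIncl q) =
      (polyIncl (derivative p) * polyIncl q - polyIncl p * polyIncl (derivative q)) /
        polyIncl q ^ 2 := by
  set f : Kz := polyIncl p / polyIncl q with hf
  have hd : polyIncl f.denom ≠ 0 := polyIncl_ne_zero f.denom_ne_zero
  have hq' := polyIncl_ne_zero hq
  have h1 : polyIncl f.num * polyIncl q = polyIncl p * polyIncl f.denom := by
    have := num_div f
    rw [hf, div_eq_div_iff (by rwa [← hf]) hq', ← hf] at this
    exact this
  have h2 : f.num * q = p * f.denom := by
    rw [← map_mul, ← map_mul] at h1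
    exact RatFunc.algebraMap_injective ℂ h1
  have h3 := congrArg polyIncl (congrArg derivative h2)
  simp only [derivative_mul, map_add, map_mul] at h3
  rw [ratDeriv, div_eq_div_iff (pow_ne_zero _ hd) (pow_ne_zero _ hq')]
  linear_combination (polyIncl q * polyIncl f.denom) * h3 -
    (polyIncl (derivative q) * polyIncl f.denom + polyIncl q * polyIncl (derivative f.denom)) * h1

/-- The derivation `d/dz` of `ℂ(z)`. -/
def dz : Derivation ℂ Kz Kz :=
  Derivation.mk'
    { toFun := ratDeriv
      map_add' := by
        intro f g
        have hf := polyIncl_ne_zero f.denom_ne_zero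
        have hg := polyIncl_ne_zero g.denom_ne_zero
        have h : f + g = polyIncl (f.num * g.denom + g.num * f.denom) /
            polyIncl (f.denom * g.denom) := by
          conv_lhs => rw [← num_div f, ← num_div g]
          simp only [map_add, map_mul]
          field_simp
        rw [h, ratDeriv_div _ _ (mul_ne_zero f.denom_ne_zero g.denom_ne_zero), ratDeriv, ratDeriv]
        simp only [derivative_mul, map_add, map_mul]
        field_simp
        ring
      map_smul' := by
        intro a f
        have hf := polyIncl_ne_zero f.denom_ne_zero
        have h : a • f = polyIncl (a • f.num) / polyIncl f.denom := by
          conv_lhs => rw [← num_div f]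
          rw [map_smul, smul_div_assoc]
        rw [h, ratDeriv_div _ _ f.denom_ne_zero, ratDeriv]
        simp only [map_smul, RingHom.id_apply, smul_mul_assoc, ← smul_sub,
          smul_div_assoc] }
    (by
      intro f g
      have hf := polyIncl_ne_zero f.denom_ne_zero
      have hg := polyIncl_ne_zero g.denom_ne_zero
      have h : f * g = polyIncl (f.num * g.num) / polyIncl (f.denom * g.denom) := by
        conv_lhs => rw [← num_div f, ← num_div g]
        simp only [map_mul]
        field_simp
      change ratDeriv (f * g) = f • ratDeriv g + g • ratDeriv f
      have e1 : f • ratDeriv g + g • ratDeriv f =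
          (polyIncl f.num / polyIncl f.denom) * ratDeriv g +
          (polyIncl g.num / polyIncl g.denom) * ratDeriv f := by
        rw [num_div, num_div]; rfl
      rw [h, ratDeriv_div _ _ (mul_ne_zero f.denom_ne_zero g.denom_ne_zero), e1, ratDeriv, ratDeriv]
      simp only [derivative_mul, map_add, map_mul]
      field_simp
      ring)

lemma dz_poly (p : ℂ[X]) : dz (polyIncl p) = polyIncl (derivative p) := by
  have := ratDeriv_div p 1 one_ne_zero
  change ratDeriv (polyIncl p) = _
  simpa using this

/-! ### The algebra `ℂ(z)[∂]` of differential operators with rational coefficients -/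

/-- Multiplication by a rational function, as an operator on `ℂ(z)`. -/
abbrev mulOp : Kz →ₐ[ℂ] Module.End ℂ Kz := Algebra.lmul ℂ Kz

/-- The operator `∂ = d/dz` on `ℂ(z)`. -/
def dOp : Module.End ℂ Kz := dz.toLinearMap

/-- `ℂ(z)[∂]`, as an algebra of operators on `ℂ(z)`. -/
def diffOps : Subalgebra ℂ (Module.End ℂ Kz) :=
  Algebra.adjoin ℂ (Set.range mulOp ∪ {dOp})

/-- The type of elements of `ℂ(z)[∂]`. -/
def DOp : Type := ↥diffOps

instance : Ring DOp := inferInstanceAs (Ring ↥diffOps)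

instance : Algebra ℂ DOp := inferInstanceAs (Algebra ℂ ↥diffOps)

/-- An element of `ℂ(z)[∂]` as an operator on `ℂ(z)`. -/
def DOp.act : DOp →ₐ[ℂ] Module.End ℂ Kz := diffOps.val

lemma DOp.act_injective : Function.Injective DOp.act := Subtype.val_injective

/-- A rational function as an element of `ℂ(z)[∂]`. -/
def fnD (f : Kz) : DOp :=
  (⟨mulOp f, Algebra.subset_adjoin (Or.inl ⟨f, rfl⟩)⟩ : ↥diffOps)

/-- `∂` as an element of `ℂ(z)[∂]`. -/
def delD : DOp := (⟨dOp, Algebra.subset_adjoin (Or.inr rfl)⟩ : ↥diffOps)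

lemma dOp_mul (a : Kz) : dOp * mulOp a = mulOp a * dOp + mulOp (dz a) := by
  ext f
  change dz (a * f) = a * dz f + dz a * f
  rw [Derivation.leibniz]
  simp [mul_comm]

/-- The operator `∑ aᵢ ∂ⁱ` with coefficients `aᵢ`. -/
def toOp : Kz[X] →ₗ[ℂ] Module.End ℂ Kz where
  toFun p := p.sum fun i a => mulOp a * dOp ^ i
  map_add' p q := Polynomial.sum_add_index _ _ _ (by simp) (by simp [add_mul])
  map_smul' r p := by
    rw [Polynomial.sum_smul_index' _ _ _ (by simp), RingHom.id_apply, Polynomial.smul_sum]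
    simp

lemma toOp_monomial (i : ℕ) (a : Kz) : toOp (monomial i a) = mulOp a * dOp ^ i := by
  change (monomial i a).sum (fun i a => mulOp a * dOp ^ i) = _
  exact Polynomial.sum_monomial_index _ _ (by simp)

lemma dz_X_pow (k : ℕ) : dz (RatFunc.X ^ (k + 1)) = ((k : ℂ) + 1) • RatFunc.X ^ k := by
  have h : (RatFunc.X : Kz) ^ (k + 1) = polyIncl (X ^ (k + 1)) := by simp
  rw [h, dz_poly, derivative_X_pow]
  simp [Algebra.smul_def]

lemma dOp_pow_X_pow (i k : ℕ) : ∃ c : ℂ, (i ≤ k → c ≠ 0) ∧ (k < i → c = 0) ∧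
    (dOp ^ i) (RatFunc.X ^ k) = c • RatFunc.X ^ (k - i) := by
  induction i with
  | zero => exact ⟨1, by simp, by simp, by simp⟩
  | succ i ih =>
    obtain ⟨c, h1, h2, h3⟩ := ih
    rw [pow_succ', Module.End.mul_apply, h3, map_smul]
    change ∃ c' : ℂ, _ ∧ _ ∧ c • dz (RatFunc.X ^ (k - i)) = _
    by_cases hk : i < k
    · obtain ⟨m, rfl⟩ : ∃ m, k = i + 1 + m := ⟨k - (i + 1), by omega⟩
      refine ⟨c * ((m : ℂ) + 1), fun _ => mul_ne_zero (h1 (by omega)) (by exact_mod_cast m.succ_ne_zero),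
        fun h => by omega, ?_⟩
      rw [show i + 1 + m - i = m + 1 by omega, show i + 1 + m - (i + 1) = m by omega, dz_X_pow,
        smul_smul]
    · refine ⟨0, fun h => by omega, fun _ => rfl, ?_⟩
      rw [show k - i = 0 by omega]
      simp

lemma toOp_injective : Function.Injective toOp := by
  rw [injective_iff_map_eq_zero]
  intro p hp
  ext k
  induction k using Nat.strong_induction_on with
  | _ k ih =>
    have h0 : toOp p (RatFunc.X ^ k) = 0 := by rw [hp]; rfl
    change (p.sum fun i a => mulOp a * dOp ^ i) _ = 0 at h0
    rw [Polynomial.sum_def, LinearMap.sum_apply, Finset.sum_eq_single k] at h0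
    · obtain ⟨c, h1, -, h3⟩ := dOp_pow_X_pow k k
      change p.coeff k * (dOp ^ k) (RatFunc.X ^ k) = 0 at h0
      rw [h3] at h0
      simpa [h1 le_rfl] using h0
    · intro i _ hik
      change p.coeff i * (dOp ^ i) (RatFunc.X ^ k) = 0
      rcases lt_or_gt_of_ne hik with h | h
      · rw [ih i h]; simp
      · obtain ⟨c, -, h2, h3⟩ := dOp_pow_X_pow i k
        rw [h3, h2 h]; simp
    · intro hk
      rw [Polynomial.notMem_support_iff.mp hk]
      simp

/-- On coefficients: `∑ aᵢ ∂ⁱ ↦ ∑ (d aᵢ/dz) ∂ⁱ`. -/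
def dCoeff : Kz[X] →ₗ[ℂ] Kz[X] where
  toFun p := p.sum fun i a => monomial i (dz a)
  map_add' p q := Polynomial.sum_add_index _ _ _ (by simp) (by simp)
  map_smul' r p := by
    rw [Polynomial.sum_smul_index' _ _ _ (by simp), RingHom.id_apply, Polynomial.smul_sum]
    refine Finset.sum_congr rfl fun i _ => ?_
    beta_reduce
    rw [Derivation.map_smul, ← smul_monomial]

lemma dCoeff_monomial (i : ℕ) (a : Kz) : dCoeff (monomial i a) = monomial i (dz a) :=
  Polynomial.sum_monomial_index (f := fun i a => monomial i (dz a)) a (by simp)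

lemma coeff_dCoeff (p : Kz[X]) (j : ℕ) : (dCoeff p).coeff j = dz (p.coeff j) := by
  induction p using Polynomial.induction_on' with
  | add p q hp hq => simp only [map_add, coeff_add, hp, hq]
  | monomial i a =>
    rw [dCoeff_monomial, coeff_monomial, coeff_monomial]
    split_ifs <;> simp

/-- On coefficients: left multiplication by `∂`. -/
def delCoeff : Kz[X] →ₗ[ℂ] Kz[X] where
  toFun p := X * p + dCoeff p
  map_add' p q := by simp only [map_add]; ring
  map_smul' r p := by
    simp

lemma toOp_delCoeff (p : Kz[X]) : toOp (delCoeff p) = dOp * toOp p := by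
  induction p using Polynomial.induction_on' with
  | add p q hp hq => simp only [map_add, mul_add, hp, hq]
  | monomial i a =>
    have : delCoeff (monomial i a) = monomial (i + 1) a + monomial i (dz a) := by
      change X * monomial i a + dCoeff (monomial i a) = _
      rw [X_mul_monomial, dCoeff_monomial]
    rw [this, map_add, toOp_monomial, toOp_monomial, toOp_monomial, ← mul_assoc, dOp_mul, pow_succ']
    noncomm_ring

lemma toOp_C_mul (a : Kz) (p : Kz[X]) : toOp (C a * p) = mulOp a * toOp p := by
  induction p using Polynomial.induction_on' with
  | add p q hp hq => simp only [map_add, mul_add, hp, hq]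
  | monomial i b =>
    rw [C_mul_monomial, toOp_monomial, toOp_monomial, map_mul, mul_assoc]

/-- On coefficients: composition of operators. -/
def starMul (p q : Kz[X]) : Kz[X] := p.sum fun i a => C a * (delCoeff^[i] q)

lemma toOp_starMul (p q : Kz[X]) : toOp (starMul p q) = toOp p * toOp q := by
  have hit : ∀ i, toOp (delCoeff^[i] q) = dOp ^ i * toOp q := by
    intro i
    induction i with
    | zero => simp
    | succ i ih => rw [Function.iterate_succ_apply', toOp_delCoeff, ih, pow_succ', mul_assoc]
  change toOp (p.sum _) = (p.sum _) * _
  rw [Polynomial.sum_def, Polynomial.sum_def, map_sum, Finset.sum_mul]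
  refine Finset.sum_congr rfl fun i _ => ?_
  rw [toOp_C_mul, hit, mul_assoc]

lemma coeff_delCoeff_iter (q : Kz[X]) {m : ℕ} (hq : q.natDegree ≤ m) (i : ℕ) :
    (delCoeff^[i] q).natDegree ≤ i + m ∧ (delCoeff^[i] q).coeff (i + m) = q.coeff m := by
  induction i with
  | zero => simpa using hq
  | succ i ih =>
    rw [Function.iterate_succ_apply']
    set r := delCoeff^[i] q
    have hc : ∀ j, (delCoeff r).coeff (j + 1) = r.coeff j + dz (r.coeff (j + 1)) := by
      intro j
      change (X * r + dCoeff r).coeff (j + 1) = _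
      rw [coeff_add, coeff_X_mul, coeff_dCoeff]
    constructor
    · rw [natDegree_le_iff_coeff_eq_zero]
      intro N hN
      obtain ⟨j, rfl⟩ : ∃ j, N = j + 1 := ⟨N - 1, by omega⟩
      rw [hc, coeff_eq_zero_of_natDegree_lt (by omega), coeff_eq_zero_of_natDegree_lt (by omega)]
      simp
    · rw [show i + 1 + m = (i + m) + 1 by omega, hc, ih.2,
        coeff_eq_zero_of_natDegree_lt (p := r) (n := i + m + 1) (by omega)]
      simp

lemma starMul_coeff (p q : Kz[X]) {n m : ℕ} (hp : p.natDegree ≤ n) (hq : q.natDegree ≤ m) :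
    (starMul p q).natDegree ≤ n + m ∧ (starMul p q).coeff (n + m) = p.coeff n * q.coeff m := by
  rw [starMul, Polynomial.sum_def]
  constructor
  · refine natDegree_sum_le_of_forall_le _ _ fun i hi => ?_
    have := le_natDegree_of_mem_supp i hi
    exact (natDegree_C_mul_le _ _).trans ((coeff_delCoeff_iter q hq i).1.trans (by omega))
  · rw [finsetSum_coeff, Finset.sum_eq_single n]
    · rw [coeff_C_mul, (coeff_delCoeff_iter q hq n).2]
    · intro i hi hne
      have := le_natDegree_of_mem_supp i hi
      rw [coeff_C_mul, coeff_eq_zero_of_natDegree_lt (p := delCoeff^[i] q), mul_zero]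
      exact (coeff_delCoeff_iter q hq i).1.trans_lt (by omega)
    · intro hn
      rw [notMem_support_iff.mp hn]; simp

lemma starMul_ne_zero {p q : Kz[X]} (hp : p ≠ 0) (hq : q ≠ 0) : starMul p q ≠ 0 := by
  intro h
  have := (starMul_coeff p q le_rfl le_rfl).2
  rw [h, coeff_zero] at this
  exact mul_ne_zero (leadingCoeff_ne_zero.mpr hp) (leadingCoeff_ne_zero.mpr hq) this.symm

lemma toOp_mem (p : Kz[X]) : toOp p ∈ diffOps := by
  refine Subalgebra.sum_mem _ fun i _ => ?_
  exact mul_mem (Subtype.property (p := (· ∈ diffOps)) (fnD _)) (pow_mem (Subtype.property (p := (· ∈ diffOps)) delD) i)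

lemma exists_toOp (P : Module.End ℂ Kz) (hP : P ∈ diffOps) : ∃ p, toOp p = P := by
  induction hP using Algebra.adjoin_induction with
  | mem x hx =>
    rcases hx with ⟨f, rfl⟩ | rfl
    · exact ⟨monomial 0 f, by rw [toOp_monomial, pow_zero, mul_one]⟩
    · exact ⟨monomial 1 1, by rw [toOp_monomial, map_one, pow_one, one_mul]⟩
  | algebraMap r => exact ⟨monomial 0 (algebraMap ℂ Kz r), by
      rw [toOp_monomial, pow_zero, mul_one]; exact AlgHom.commutes mulOp r⟩
  | add x y _ _ hx hy =>
    obtain ⟨p, rfl⟩ := hx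
    obtain ⟨q, rfl⟩ := hy
    exact ⟨p + q, map_add _ _ _⟩
  | mul x y _ _ hx hy =>
    obtain ⟨p, rfl⟩ := hx
    obtain ⟨q, rfl⟩ := hy
    exact ⟨_, toOp_starMul p q⟩

/-- Every element of `ℂ(z)[∂]` is uniquely of the form `∑ aᵢ ∂ⁱ`. -/
def coeffEquiv : Kz[X] ≃ₗ[ℂ] DOp :=
  LinearEquiv.ofBijective (toOp.codRestrict (Subalgebra.toSubmodule diffOps) toOp_mem)
    ⟨fun _ _ h => toOp_injective (congrArg Subtype.val h),
      fun P => (exists_toOp P.1 P.2).imp fun _ h => Subtype.ext h⟩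

lemma coeffEquiv_coe (p : Kz[X]) : DOp.act (coeffEquiv p) = toOp p := rfl

lemma coeffEquiv_starMul (p q : Kz[X]) :
    coeffEquiv (starMul p q) = coeffEquiv p * coeffEquiv q :=
  DOp.act_injective (toOp_starMul p q)

instance : Nontrivial DOp := inferInstanceAs (Nontrivial ↥diffOps)

instance : NoZeroDivisors DOp where
  eq_zero_or_eq_zero_of_mul_eq_zero := by
    intro P Q h
    obtain ⟨p, rfl⟩ := coeffEquiv.surjective P
    obtain ⟨q, rfl⟩ := coeffEquiv.surjective Q
    rw [← coeffEquiv_starMul, LinearEquiv.map_eq_zero_iff] at h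
    by_contra hc
    rw [not_or] at hc
    refine starMul_ne_zero ?_ ?_ h
    · rintro rfl; exact hc.1 (map_zero _)
    · rintro rfl; exact hc.2 (map_zero _)

lemma exists_div (q : Kz[X]) (hq : q ≠ 0) (n : ℕ) (p : Kz[X]) (hp : p.degree < n) :
    ∃ u t, p = starMul u q + t ∧ t.degree < q.degree := by
  induction n generalizing p with
  | zero =>
    refine ⟨0, 0, ?_, by simpa [bot_lt_iff_ne_bot] using hq⟩
    have : p = 0 := by simpa using hp
    simp [this, starMul]
  | succ n ih =>
    by_cases hd : p.degree < q.degree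
    · exact ⟨0, p, by simp [starMul], hd⟩
    · have hqp : q.degree < (n + 1 : ℕ) := (not_lt.mp hd).trans_lt hp
      have hqn : q.natDegree ≤ n := by
        rw [degree_eq_natDegree hq] at hqp
        exact Nat.lt_succ_iff.mp (by exact_mod_cast hqp)
      set v : Kz[X] := monomial (n - q.natDegree) (p.coeff n / q.leadingCoeff) with hv
      have hs := starMul_coeff v q (natDegree_monomial_le _) le_rfl
      have hlt : (p - starMul v q).degree < n := by
        rw [degree_lt_iff_coeff_zero]
        intro j hj
        rw [coeff_sub]
        rcases hj.eq_or_lt with rfl | hj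
        · have h2 := hs.2
          rw [Nat.sub_add_cancel hqn, hv, coeff_monomial_same] at h2
          rw [h2, coeff_natDegree, div_mul_cancel₀ _ (leadingCoeff_ne_zero.mpr hq), sub_self]
        · rw [coeff_eq_zero_of_natDegree_lt (p := starMul v q) (by omega),
            (degree_lt_iff_coeff_zero p (n + 1)).mp hp j hj, sub_zero]
      obtain ⟨u, t, h, ht⟩ := ih _ hlt
      refine ⟨v + u, t, ?_, ht⟩
      have hadd : starMul (v + u) q = starMul v q + starMul u q :=
        Polynomial.sum_add_index _ _ _ (by simp) (by simp [add_mul])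
      rw [hadd, add_assoc, ← h]; ring

lemma exists_ore (n : ℕ) (p q : Kz[X]) (hq : q ≠ 0) (hn : q.natDegree < n) :
    ∃ u v : DOp, v ≠ 0 ∧ v * coeffEquiv p = u * coeffEquiv q := by
  induction n generalizing p q with
  | zero => omega
  | succ n ih =>
    obtain ⟨u, t, h, ht⟩ := exists_div q hq (p.natDegree + 1) p
      (degree_le_natDegree.trans_lt (by exact_mod_cast Nat.lt_succ_self _))
    have hp : coeffEquiv p = coeffEquiv u * coeffEquiv q + coeffEquiv t := by
      rw [h, map_add, coeffEquiv_starMul]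
    by_cases h0 : t = 0
    · exact ⟨coeffEquiv u, 1, one_ne_zero, by rw [hp, h0]; simp⟩
    · obtain ⟨r, s, hs, hrs⟩ := ih q t h0 ((natDegree_lt_natDegree h0 ht).trans_le (by omega))
      refine ⟨r * coeffEquiv u + s, r, ?_, ?_⟩
      · rintro rfl
        rw [zero_mul] at hrs
        rcases mul_eq_zero.mp hrs with h | h
        · exact hs h
        · exact hq (by simpa using h)
      · rw [hp, mul_add, ← hrs]
        noncomm_ring

instance : OreLocalization.OreSet (nonZeroDivisors DOp) :=
  Classical.choice <| OreLocalization.nonempty_oreSet_iff_of_noZeroDivisors.mpr <| by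
    intro r s
    obtain ⟨p, rfl⟩ := coeffEquiv.surjective r
    obtain ⟨q, hq⟩ := coeffEquiv.surjective s.1
    have hq0 : q ≠ 0 := by
      rintro rfl
      exact nonZeroDivisors.coe_ne_zero s (by rw [← hq, map_zero])
    obtain ⟨u, v, hv, h⟩ := exists_ore _ p q hq0 (Nat.lt_succ_self _)
    exact ⟨u, ⟨v, mem_nonZeroDivisors_of_ne_zero hv⟩, by rw [← hq]; exact h⟩

/-! ### The formal adjoint on `ℂ(z)[∂]` -/

/-- `∑ aᵢ ∂ⁱ ↦ ∑ (-∂)ⁱ aᵢ`, in terms of the coefficients `aᵢ`. -/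
def adjCoeff : Kz[X] →ₗ[ℂ] DOp where
  toFun p := p.sum fun i a => (-delD) ^ i * fnD a
  map_add' p q := Polynomial.sum_add_index _ _ _ (fun i => by
    rw [show fnD 0 = 0 from DOp.act_injective (map_zero mulOp), mul_zero]) (fun i a b => by
    rw [show fnD (a + b) = fnD a + fnD b from DOp.act_injective (map_add mulOp a b), mul_add])
  map_smul' r p := by
    rw [Polynomial.sum_smul_index' _ _ _ (fun i => by
      rw [show fnD 0 = 0 from DOp.act_injective (map_zero mulOp), mul_zero]), RingHom.id_apply,
      Polynomial.smul_sum]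
    refine Finset.sum_congr rfl fun i _ => ?_
    beta_reduce
    rw [show fnD (r • p.coeff i) = r • fnD (p.coeff i) from DOp.act_injective (map_smul mulOp r _)]
    exact mul_smul_comm _ _ _

lemma adjCoeff_monomial (i : ℕ) (a : Kz) : adjCoeff (monomial i a) = (-delD) ^ i * fnD a :=
  Polynomial.sum_monomial_index (f := fun i a => (-delD) ^ i * fnD a) a (by
    rw [show fnD 0 = 0 from DOp.act_injective (map_zero mulOp), mul_zero])

/-- The formal adjoint `D ↦ D*` as a linear map. -/
def adjLin : DOp →ₗ[ℂ] DOp := adjCoeff ∘ₗ coeffEquiv.symm.toLinearMap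

lemma coeffEquiv_monomial (i : ℕ) (a : Kz) :
    coeffEquiv (monomial i a) = fnD a * delD ^ i :=
  DOp.act_injective (toOp_monomial i a)

lemma adjLin_term (i : ℕ) (a : Kz) : adjLin (fnD a * delD ^ i) = (-delD) ^ i * fnD a := by
  rw [← coeffEquiv_monomial, adjLin, LinearMap.comp_apply, LinearEquiv.coe_coe,
    LinearEquiv.symm_apply_apply, adjCoeff_monomial]

lemma fnD_one : fnD 1 = 1 := DOp.act_injective (map_one mulOp)

lemma fnD_mul (a b : Kz) : fnD (a * b) = fnD a * fnD b := DOp.act_injective (map_mul mulOp a b)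

lemma fnD_algebraMap (r : ℂ) : fnD (algebraMap ℂ Kz r) = algebraMap ℂ DOp r :=
  DOp.act_injective (AlgHom.commutes mulOp r)

lemma delD_mul_fnD (a : Kz) : delD * fnD a = fnD a * delD + fnD (dz a) := DOp.act_injective (dOp_mul a)

lemma adjLin_fnD (a : Kz) : adjLin (fnD a) = fnD a := by
  simpa using adjLin_term 0 a

lemma adjLin_delD : adjLin delD = -delD := by
  simpa [fnD_one] using adjLin_term 1 1

/-- Induction over `ℂ(z)[∂]` through the terms `a ∂ⁱ`. -/
lemma DOp_induction {motive : DOp → Prop} (P : DOp)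
    (add : ∀ P Q, motive P → motive Q → motive (P + Q))
    (term : ∀ i a, motive (fnD a * delD ^ i)) : motive P := by
  obtain ⟨p, rfl⟩ := coeffEquiv.surjective P
  induction p using Polynomial.induction_on' with
  | add p q hp hq => rw [map_add]; exact add _ _ hp hq
  | monomial i a => rw [coeffEquiv_monomial]; exact term i a

lemma adjLin_fnD_mul (a : Kz) (Q : DOp) : adjLin (fnD a * Q) = adjLin Q * fnD a := by
  induction Q using DOp_induction with
  | add P Q hP hQ => rw [mul_add, map_add, map_add, hP, hQ, add_mul]
  | term i b =>
    rw [← mul_assoc, ← fnD_mul, adjLin_term, adjLin_term, mul_comm a b, fnD_mul, mul_assoc]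

lemma adjLin_delD_mul (Q : DOp) : adjLin (delD * Q) = adjLin Q * (-delD) := by
  induction Q using DOp_induction with
  | add P Q hP hQ => rw [mul_add, map_add, map_add, hP, hQ, add_mul]
  | term i b =>
    rw [← mul_assoc, delD_mul_fnD, add_mul, mul_assoc, ← pow_succ', map_add, adjLin_term,
      adjLin_term, adjLin_term, pow_succ, mul_assoc, ← mul_add, mul_assoc]
    congr 1
    have h1 : -delD * fnD b = -(delD * fnD b) := neg_mul _ _
    have h2 : fnD b * -delD = -(fnD b * delD) := mul_neg _ _
    rw [h1, h2, delD_mul_fnD]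
    abel

lemma adjLin_mul (P Q : DOp) : adjLin (P * Q) = adjLin Q * adjLin P := by
  induction P using DOp_induction with
  | add P P' hP hP' => rw [add_mul, map_add, map_add, hP, hP', mul_add]
  | term i a =>
    have h : ∀ R, adjLin (delD ^ i * R) = adjLin R * (-delD) ^ i := by
      induction i with
      | zero => simp
      | succ i ih => intro R; rw [pow_succ', mul_assoc, adjLin_delD_mul, ih, pow_succ, mul_assoc]
    rw [mul_assoc, adjLin_fnD_mul, h, adjLin_term, mul_assoc]

/-- The formal adjoint as a homomorphism from `ℂ(z)[∂]` to its opposite. -/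
def adjD : DOp →+* DOpᵐᵒᵖ where
  toFun P := MulOpposite.op (adjLin P)
  map_one' := by
    rw [← fnD_one, adjLin_fnD, fnD_one, MulOpposite.op_one]
  map_mul' P Q := by rw [adjLin_mul, MulOpposite.op_mul]
  map_zero' := by rw [map_zero, MulOpposite.op_zero]
  map_add' P Q := by rw [map_add, MulOpposite.op_add]

lemma adjLin_adjLin (P : DOp) : adjLin (adjLin P) = P := by
  induction P using DOp_induction with
  | add P Q hP hQ => rw [map_add, map_add, hP, hQ]
  | term i a =>
    rw [adjLin_mul, adjLin_mul, adjLin_fnD, adjLin_fnD]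
    congr 1
    have h : ∀ P : DOp, adjLin (P ^ i) = adjLin P ^ i := fun P =>
      MulOpposite.op_injective (map_pow adjD P i)
    rw [h, h, adjLin_delD, map_neg, adjLin_delD, neg_neg]

/-! ### The quotient skew field `Q` and the Weyl algebra `A₁ = ℂ[z, ∂]` -/

/-- The skew field of fractions of `ℂ(z)[∂]`; it is also the one of `A₁`
(see `exists_weyl_fraction`). -/
def Q : Type := OreLocalization (nonZeroDivisors DOp) DOp

instance : DivisionRing Q :=
  inferInstanceAs (DivisionRing (OreLocalization (nonZeroDivisors DOp) DOp))

instance : Algebra ℂ Q :=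
  inferInstanceAs (Algebra ℂ (OreLocalization (nonZeroDivisors DOp) DOp))

/-- The inclusion `ℂ(z)[∂] ⊆ Q`. -/
def inclQ : DOp →+* Q :=
  OreLocalization.numeratorRingHom (R := DOp) (S := nonZeroDivisors DOp)

lemma inclQ_injective : Function.Injective inclQ :=
  OreLocalization.numeratorHom_inj (S := nonZeroDivisors DOp) inf_le_left

/-- The Weyl algebra `A₁ = ℂ[z, ∂] ⊆ Q`, with generators `x = ∂` and `y = z`. -/
def weyl : Subalgebra ℂ Q := Algebra.adjoin ℂ {inclQ delD, inclQ (fnD RatFunc.X)}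

lemma del_mem_weyl : inclQ delD ∈ weyl := Algebra.subset_adjoin (Or.inl rfl)

lemma z_mem_weyl : inclQ (fnD RatFunc.X) ∈ weyl := Algebra.subset_adjoin (Or.inr rfl)

/-- The extension to `Q` of the formal adjoint, as a homomorphism to the opposite ring. -/
def cHom : Q →+* Qᵐᵒᵖ :=
  OreLocalization.universalHom ((RingHom.op inclQ).comp adjD)
    (IsUnit.liftRight
      (((RingHom.op inclQ).comp adjD).toMonoidHom.comp (nonZeroDivisors DOp).subtype)
      (by
        intro s
        refine IsUnit.mk0 _ ?_
        change MulOpposite.op (inclQ (adjLin s.1)) ≠ 0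
        rw [Ne, MulOpposite.op_eq_zero_iff, map_eq_zero_iff _ inclQ_injective]
        intro h
        refine nonZeroDivisors.coe_ne_zero s ?_
        rw [← adjLin_adjLin s.1, h, map_zero]))
    (fun s => by rfl)

/-- The anti-automorphism `c` of `Q` which extends the anti-automorphism
`∂ ↦ -∂`, `z ↦ z` of `A₁` and the formal adjoint of `ℂ(z)[∂]`. -/
def c (q : Q) : Q := (cHom q).unop

lemma c_add (p q : Q) : c (p + q) = c p + c q := by
  rw [c, map_add]; rfl

lemma c_mul (p q : Q) : c (p * q) = c q * c p := by
  rw [c, map_mul]; rfl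

lemma c_zero : c 0 = 0 := by
  rw [c, map_zero]; rfl

lemma c_inclQ (P : DOp) : c (inclQ P) = inclQ (adjLin P) :=
  congrArg MulOpposite.unop (OreLocalization.universalHom_commutes _ _ _)

lemma c_del : c (inclQ delD) = -inclQ delD := by rw [c_inclQ, adjLin_delD, map_neg]

lemma c_fn (f : Kz) : c (inclQ (fnD f)) = inclQ (fnD f) := by rw [c_inclQ, adjLin_fnD]

lemma c_algebraMap (r : ℂ) : c (algebraMap ℂ Q r) = algebraMap ℂ Q r := by
  change c (inclQ (algebraMap ℂ DOp r)) = inclQ (algebraMap ℂ DOp r)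
  rw [← fnD_algebraMap, c_fn]

lemma c_c (q : Q) : c (c q) = q := by
  have h : ((RingEquiv.opOp Q).symm.toRingHom.comp (RingHom.op cHom)).comp cHom = RingHom.id Q := by
    have h1 := OreLocalization.universalHom_unique inclQ
      (IsUnit.liftRight (inclQ.toMonoidHom.comp (nonZeroDivisors DOp).subtype)
        (by
          intro s
          refine IsUnit.mk0 _ ?_
          change inclQ s.1 ≠ 0
          rw [Ne, map_eq_zero_iff _ inclQ_injective]
          exact nonZeroDivisors.coe_ne_zero s))
      (fun s => by rfl)
    rw [h1 (RingHom.id Q) fun r => rfl]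
    refine h1 _ fun r => ?_
    change c (c (inclQ r)) = inclQ r
    rw [c_inclQ, c_inclQ, adjLin_adjLin]
  exact congrArg (fun f : Q →+* Q => f q) h

lemma c_mem_weyl {a : Q} (ha : a ∈ weyl) : c a ∈ weyl := by
  induction ha using Algebra.adjoin_induction with
  | mem x hx =>
    rcases hx with rfl | rfl
    · rw [c_del]
      exact neg_mem del_mem_weyl
    · rw [c_fn]
      exact z_mem_weyl
  | algebraMap r => rw [c_algebraMap]; exact algebraMap_mem _ _
  | add x y _ _ hx hy => rw [c_add]; exact add_mem hx hy
  | mul x y _ _ hx hy => rw [c_mul]; exact mul_mem hy hx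

lemma poly_mem_weyl (p : ℂ[X]) : inclQ (fnD (polyIncl p)) ∈ weyl := by
  induction p using Polynomial.induction_on' with
  | add p q hp hq =>
    rw [map_add, show ∀ a b, fnD (a + b) = fnD a + fnD b from
      fun a b => DOp.act_injective (map_add mulOp a b), map_add]
    exact add_mem hp hq
  | monomial n a =>
    have h : polyIncl (monomial n a) = algebraMap ℂ Kz a * RatFunc.X ^ n := by
      rw [← C_mul_X_pow_eq_monomial]; simp
    have hpow : fnD (RatFunc.X ^ n) = fnD RatFunc.X ^ n := DOp.act_injective (map_pow mulOp _ n)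
    rw [h, fnD_mul, fnD_algebraMap, hpow, map_mul, map_pow]
    exact mul_mem (algebraMap_mem weyl a) (pow_mem z_mem_weyl n)

lemma exists_poly_mul_mem_weyl (P : DOp) :
    ∃ p : ℂ[X], p ≠ 0 ∧ inclQ (fnD (polyIncl p) * P) ∈ weyl := by
  induction P using DOp_induction with
  | add P R hP hR =>
    obtain ⟨p, hp, h1⟩ := hP
    obtain ⟨r, hr, h2⟩ := hR
    refine ⟨p * r, mul_ne_zero hp hr, ?_⟩
    have h : fnD (polyIncl (p * r)) * (P + R) =
        fnD (polyIncl r) * (fnD (polyIncl p) * P) + fnD (polyIncl p) * (fnD (polyIncl r) * R) := by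
      rw [mul_add, ← mul_assoc, ← mul_assoc, ← fnD_mul, ← fnD_mul, ← map_mul, ← map_mul, mul_comm r p]
    rw [h, map_add, map_mul inclQ (fnD (polyIncl r)) (fnD (polyIncl p) * P),
      map_mul inclQ (fnD (polyIncl p)) (fnD (polyIncl r) * R)]
    exact add_mem (mul_mem (poly_mem_weyl _) h1) (mul_mem (poly_mem_weyl _) h2)
  | term i a =>
    refine ⟨a.denom, a.denom_ne_zero, ?_⟩
    have h : polyIncl a.denom * a = polyIncl a.num := by
      have := polyIncl_ne_zero a.denom_ne_zero
      have h2 := num_div a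
      rw [div_eq_iff this] at h2
      rw [h2, mul_comm]
    rw [← mul_assoc, ← fnD_mul, h, map_mul, map_pow]
    exact mul_mem (poly_mem_weyl _) (pow_mem del_mem_weyl i)

lemma exists_fraction (q : Q) :
    ∃ (r : DOp) (s : nonZeroDivisors DOp), inclQ s.1 * q = inclQ r := by
  induction q using OreLocalization.ind with
  | _ r s => exact ⟨r, s, OreLocalization.mul_cancel⟩

/-- `Q` is the quotient skew field of `A₁`. -/
lemma exists_weyl_fraction (q : Q) : ∃ a ∈ weyl, ∃ s ∈ weyl, s ≠ 0 ∧ q = s⁻¹ * a := by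
  obtain ⟨r, s, hq⟩ := exists_fraction q
  obtain ⟨p, hp, h1⟩ := exists_poly_mul_mem_weyl r
  obtain ⟨t, ht, h2⟩ := exists_poly_mul_mem_weyl s.1
  have hs : inclQ s.1 ≠ 0 := by
    rw [Ne, map_eq_zero_iff _ inclQ_injective]
    exact nonZeroDivisors.coe_ne_zero s
  have hne : ∀ p : ℂ[X], p ≠ 0 → inclQ (fnD (polyIncl p)) ≠ 0 := by
    intro p hp
    rw [Ne, map_eq_zero_iff _ inclQ_injective]
    intro h
    have := congrArg (fun P : DOp => P.act 1) h
    change polyIncl p * 1 = 0 at this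
    rw [mul_one] at this
    exact polyIncl_ne_zero hp this
  refine ⟨inclQ (fnD (polyIncl (p * t)) * r), ?_, inclQ (fnD (polyIncl (p * t)) * s.1), ?_, ?_, ?_⟩
  · rw [mul_comm p t, map_mul polyIncl, fnD_mul, mul_assoc, map_mul]
    exact mul_mem (poly_mem_weyl _) h1
  · rw [map_mul polyIncl, fnD_mul, mul_assoc, map_mul]
    exact mul_mem (poly_mem_weyl _) h2
  · rw [map_mul]
    exact mul_ne_zero (hne _ (mul_ne_zero hp ht)) hs
  · rw [map_mul inclQ, map_mul inclQ, mul_inv_rev, mul_assoc, inv_mul_cancel_left₀ (hne _ (mul_ne_zero hp ht)),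
      ← hq, inv_mul_cancel_left₀ hs]

lemma weyl_preserves_poly {a : Q} (ha : a ∈ weyl) :
    ∃ P : DOp, inclQ P = a ∧ ∀ p : ℂ[X], ∃ r : ℂ[X], P.act (polyIncl p) = polyIncl r := by
  induction ha using Algebra.adjoin_induction with
  | mem x hx =>
    rcases hx with rfl | rfl
    · exact ⟨delD, rfl, fun p => ⟨derivative p, dz_poly p⟩⟩
    · refine ⟨fnD RatFunc.X, rfl, fun p => ⟨X * p, ?_⟩⟩
      change RatFunc.X * polyIncl p = _
      simp
  | algebraMap r =>
    refine ⟨algebraMap ℂ DOp r, rfl, fun p => ⟨r • p, ?_⟩⟩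
    rw [map_smul]; rfl
  | add x y _ _ hx hy =>
    obtain ⟨P, rfl, hP⟩ := hx
    obtain ⟨R, rfl, hR⟩ := hy
    refine ⟨P + R, map_add _ _ _, fun p => ?_⟩
    obtain ⟨u, hu⟩ := hP p
    obtain ⟨v, hv⟩ := hR p
    refine ⟨u + v, ?_⟩
    rw [map_add polyIncl, ← hu, ← hv]; rfl
  | mul x y _ _ hx hy =>
    obtain ⟨P, rfl, hP⟩ := hx
    obtain ⟨R, rfl, hR⟩ := hy
    refine ⟨P * R, map_mul _ _ _, fun p => ?_⟩
    obtain ⟨v, hv⟩ := hR p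
    obtain ⟨u, hu⟩ := hP v
    refine ⟨u, ?_⟩
    rw [← hu, ← hv]; rfl

/-! ### Right and left `A₁`-submodules of `Q` -/

/-- Right `A₁`-submodules of `Q`. -/
abbrev RightSub : Type := Submodule weyl.op Q

/-- Left `A₁`-submodules of `Q`. -/
abbrev LeftSub : Type := Submodule weyl Q

/-- The left `A₁`-module `c(I)`, for a right `A₁`-module `I ⊆ Q`. -/
def cRight (I : RightSub) : LeftSub where
  carrier := c '' I
  add_mem' := by
    rintro _ _ ⟨i, hi, rfl⟩ ⟨j, hj, rfl⟩
    exact ⟨i + j, I.add_mem hi hj, c_add i j⟩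
  zero_mem' := ⟨0, I.zero_mem, c_zero⟩
  smul_mem' := by
    rintro ⟨a, ha⟩ _ ⟨i, hi, rfl⟩
    refine ⟨i * c a, I.smul_mem ⟨MulOpposite.op (c a), c_mem_weyl ha⟩ hi, ?_⟩
    rw [c_mul, c_c]; rfl

/-- The right `A₁`-module `c(J)`, for a left `A₁`-module `J ⊆ Q`. -/
def cLeft (J : LeftSub) : RightSub where
  carrier := c '' J
  add_mem' := by
    rintro _ _ ⟨i, hi, rfl⟩ ⟨j, hj, rfl⟩
    exact ⟨i + j, J.add_mem hi hj, c_add i j⟩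
  zero_mem' := ⟨0, J.zero_mem, c_zero⟩
  smul_mem' := by
    rintro ⟨a, ha⟩ _ ⟨i, hi, rfl⟩
    refine ⟨c a.unop * i, J.smul_mem ⟨c a.unop, c_mem_weyl ha⟩ hi, ?_⟩
    rw [c_mul, c_c]; rfl

/-- The dual `J' = {q ∈ Q : J q ⊆ A₁}` of a left `A₁`-module `J ⊆ Q`. -/
def dualRight (J : LeftSub) : RightSub where
  carrier := {q | ∀ j ∈ J, j * q ∈ weyl}
  add_mem' := by
    intro p q hp hq j hj
    rw [mul_add]
    exact add_mem (hp j hj) (hq j hj)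
  zero_mem' := by
    intro j _
    rw [mul_zero]
    exact zero_mem _
  smul_mem' := by
    rintro ⟨a, ha⟩ q hq j hj
    change j * (q * a.unop) ∈ weyl
    rw [← mul_assoc]
    exact mul_mem (hq j hj) ha

/-- `I` is a non-zero right ideal of `A₁`. -/
def IsNonzeroRightIdeal (I : RightSub) : Prop := I ≠ ⊥ ∧ ∀ q ∈ I, q ∈ weyl

/-- The class of all non-zero right ideals of `A₁` that are isomorphic to the given
`F` as right `A₁`-modules. -/
def isoClass (F : RightSub) : Set RightSub :=
  {I | IsNonzeroRightIdeal I ∧ Nonempty (I ≃ₗ[weyl.op] F)}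

/-- The set `ℛ` of isomorphism classes of non-zero right ideals of `A₁`. -/
def isoClasses : Set (Set RightSub) :=
  {C | ∃ I, IsNonzeroRightIdeal I ∧ C = isoClass I}

/-- The action of `c` on isomorphism classes of right ideals: the class of `I` goes to the class
of the dual of the left ideal `c(I)`. -/
def cStar (C : Set RightSub) : Set RightSub := ⋃ I ∈ C, isoClass (dualRight (cRight I))

/-! ### The adelic Grassmannian -/

/-- `V ⊆ ℂ[z]` is `l`-primary: it contains `(z - l)^r ℂ[z]` for some `r`. -/
def IsPrimary (l : ℂ) (V : Submodule ℂ ℂ[X]) : Prop :=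
  ∃ r : ℕ, ∀ p : ℂ[X], (X - C l) ^ r * p ∈ V

/-- The polynomial `∏ (z - l)^(codim V_l)`. -/
def adPoly (s : Finset ℂ) (V : ℂ → Submodule ℂ ℂ[X]) : ℂ[X] :=
  ∏ l ∈ s, (X - C l) ^ Module.finrank ℂ (ℂ[X] ⧸ V l)

/-- The adelic Grassmannian: all spaces `m⁻¹ V ⊆ ℂ(z)`, where `V = ⋂ V_l` is a finite
intersection of `l`-primary subspaces (one for each of finitely many points `l`)
and `m = ∏ (z - l)^(codim V_l)`. -/
def Gr : Set (Submodule ℂ Kz) :=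
  {W | ∃ (s : Finset ℂ) (V : ℂ → Submodule ℂ ℂ[X]), (∀ l ∈ s, IsPrimary l (V l)) ∧
    W = ((⨅ l ∈ s, V l).map polyIncl.toLinearMap).map (mulOp (polyIncl (adPoly s V))⁻¹)}

/-- The fractional right ideal `R_W = {D ∈ ℂ(z)[∂] : D.ℂ[z] ⊆ W}`. -/
def rIdeal (W : Submodule ℂ Kz) : RightSub where
  carrier := inclQ '' {P | ∀ p : ℂ[X], P.act (polyIncl p) ∈ W}
  add_mem' := by
    rintro _ _ ⟨P, hP, rfl⟩ ⟨R, hR, rfl⟩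
    exact ⟨P + R, fun p => W.add_mem (hP p) (hR p), map_add _ _ _⟩
  zero_mem' := ⟨0, fun _ => W.zero_mem, map_zero _⟩
  smul_mem' := by
    rintro ⟨a, ha⟩ _ ⟨P, hP, rfl⟩
    obtain ⟨A, hA, hA'⟩ := weyl_preserves_poly (a := a.unop) ha
    refine ⟨P * A, fun p => ?_, ?_⟩
    · obtain ⟨r, hr⟩ := hA' p
      change P.act (A.act (polyIncl p)) ∈ W
      rw [hr]
      exact hP r
    · rw [map_mul, hA]; rfl

/-- The fractional left ideal `L_W = {D ∈ ℂ(z)[∂] : D.W ⊆ ℂ[z]}`. -/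
def lIdeal (W : Submodule ℂ Kz) : LeftSub where
  carrier := inclQ '' {P | ∀ f ∈ W, P.act f ∈ polyIncl.range}
  add_mem' := by
    rintro _ _ ⟨P, hP, rfl⟩ ⟨R, hR, rfl⟩
    exact ⟨P + R, fun f hf => add_mem (hP f hf) (hR f hf), map_add _ _ _⟩
  zero_mem' := ⟨0, fun _ _ => zero_mem _, map_zero _⟩
  smul_mem' := by
    rintro ⟨a, ha⟩ _ ⟨P, hP, rfl⟩
    obtain ⟨A, hA, hA'⟩ := weyl_preserves_poly ha
    refine ⟨A * P, fun f hf => ?_, ?_⟩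
    · obtain ⟨p, hp⟩ := hP f hf
      obtain ⟨r, hr⟩ := hA' p
      refine ⟨r, ?_⟩
      change polyIncl r = A.act (P.act f)
      rw [← hp]
      exact hr.symm
    · rw [map_mul, hA]; rfl

/-- The isomorphism class `α(W)` of `R_W`. -/
def alpha (W : Submodule ℂ Kz) : Set RightSub := isoClass (rIdeal W)

/-! ### The residue pairing -/

/-- The ring homomorphism `p(z) ↦ p(w⁻¹)` from polynomials to Laurent series in `w`. -/
def polyExpand : ℂ[X] →+* LaurentSeries ℂ :=
  eval₂RingHom HahnSeries.C (HahnSeries.single (-1 : ℤ) (1 : ℂ))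

lemma polyExpand_coeff (p : ℂ[X]) (n : ℕ) : (polyExpand p).coeff (-n) = p.coeff n := by
  induction p using Polynomial.induction_on' with
  | add p q hp hq => rw [map_add, HahnSeries.coeff_add, hp, hq, coeff_add]
  | monomial i a =>
    rw [polyExpand, coe_eval₂RingHom, eval₂_monomial, HahnSeries.single_pow, coeff_monomial,
      HahnSeries.C_mul_eq_smul, HahnSeries.coeff_smul, HahnSeries.coeff_single]
    by_cases h : i = n
    · simp [h]
    · have h2 : n ≠ i := fun e => h e.symm
      simp [h, h2]

lemma polyExpand_nonZeroDivisors :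
    nonZeroDivisors ℂ[X] ≤ (nonZeroDivisors (LaurentSeries ℂ)).comap polyExpand := by
  intro p hp
  refine mem_nonZeroDivisors_of_ne_zero fun h => nonZeroDivisors.ne_zero hp ?_
  ext n
  rw [← polyExpand_coeff p n]
  exact congrArg (fun f : LaurentSeries ℂ => f.coeff (-n)) h

/-- The Laurent expansion at `z = ∞` of a rational function, in the coordinate `w = 1/z`. -/
def expandInfty : Kz →+* LaurentSeries ℂ :=
  RatFunc.liftRingHom polyExpand polyExpand_nonZeroDivisors

lemma expandInfty_smul (a : ℂ) (f : Kz) : expandInfty (a • f) = a • expandInfty f := by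
  rw [RatFunc.smul_eq_C_mul, map_mul, ← HahnSeries.C_mul_eq_smul]
  congr 1
  rw [expandInfty, RatFunc.liftRingHom_C]
  exact eval₂_C _ _

/-- The residue at `∞` of `f dz`. As `dz = -w⁻² dw` for `w = 1/z`, it is
minus the coefficient of `w = z⁻¹` in the expansion of `f` at `∞`. -/
def resInfty : Kz →ₗ[ℂ] ℂ where
  toFun f := -(expandInfty f).coeff 1
  map_add' f g := by rw [map_add, HahnSeries.coeff_add]; ring
  map_smul' a f := by rw [expandInfty_smul, HahnSeries.coeff_smul]; simp

/-- The annihilator `W*` of `W` for the symmetric bilinear form `⟨f, g⟩ = res_∞ f g dz`. -/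
def annih (W : Submodule ℂ Kz) : Submodule ℂ Kz where
  carrier := {f | ∀ g ∈ W, resInfty (f * g) = 0}
  add_mem' := by
    intro f f' hf hf' g hg
    rw [add_mul, map_add, hf g hg, hf' g hg, add_zero]
  zero_mem' := by
    intro g _
    rw [zero_mul, map_zero]
  smul_mem' := by
    intro a f hf g hg
    rw [smul_mul_assoc, map_smul, hf g hg, smul_zero]

end AdelicGr

end

noncomputable section

namespace AdelicGr

/-! ### The residue pairing and the formal adjoint -/

/-! Exact differentials have no residue at infinity (`resInfty_dz`), so integration by parts makes
the formal adjoint the adjoint for the residue pairing (`resInfty_adjLin`). Under this pairing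
`ℂ[z]` is its own annihilator, hence `D` maps `ℂ[z]` into `W*` iff its adjoint maps `W` into `ℂ[z]`:
this is `R_{W*} = c(L_W)`.

Two facts identify `c(L_W)` with the dual of `c(R_W)`: `A₁` consists of the operators preserving
`ℂ[z]`, and `W` is spanned by `R_W.ℂ[z]` (`le_of_forall_act_mem`). So `c ⋆ α(W) = α(W*)`, and the
equivalence reduces to injectivity of `α`. An isomorphism `R_W ≅ R_U` is left multiplication by some
`q ∈ Q`. As both ideals contain non-zero functions, `q` and `q⁻¹` are differential operators, so `q`
is a function `g` and `U = gW`. The codimension condition in `Gr` fixes the order of `g` at every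
point to be zero, so `g` is constant.

For `W* ∈ Gr`, points of `Gr` are described by `NormalAt`. With `P = ∏ (z - l)`, the space `W` lies
between `P^N ℂ[z]` and `P^(-N) ℂ[z]`, is stable under polynomials locally constant to order `2N`,
and fills exactly half of the `2N` dimensions at each `l`. Each condition is self-dual; for the
last, the residue pairing is localized at `l` by an idempotent and becomes non-degenerate on
`ℂ[z]/(z - l)^(2N)`. -/

lemma expandInfty_polyIncl (p : ℂ[X]) : expandInfty (polyIncl p) = polyExpand p :=
  RatFunc.liftRingHom_algebraMap polyExpand polyExpand_nonZeroDivisors p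

lemma polyExpand_coeff_pos (p : ℂ[X]) {n : ℤ} (hn : 0 < n) : (polyExpand p).coeff n = 0 := by
  induction p using Polynomial.induction_on' with
  | add p q hp hq => rw [map_add, HahnSeries.coeff_add, hp, hq, add_zero]
  | monomial i a =>
    rw [polyExpand, coe_eval₂RingHom, eval₂_monomial, HahnSeries.single_pow,
      HahnSeries.C_mul_eq_smul, HahnSeries.coeff_smul, HahnSeries.coeff_single_of_ne, smul_zero]
    simp only [nsmul_eq_mul, mul_neg, mul_one]
    omega

lemma expandInfty_X : expandInfty RatFunc.X = HahnSeries.single (-1 : ℤ) (1 : ℂ) := by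
  rw [← RatFunc.algebraMap_X]
  exact (expandInfty_polyIncl X).trans (eval₂_X _ _)

lemma resInfty_polyIncl (p : ℂ[X]) : resInfty (polyIncl p) = 0 := by
  change -(expandInfty (polyIncl p)).coeff 1 = 0
  rw [expandInfty_polyIncl, polyExpand_coeff_pos p one_pos, neg_zero]

/-- The space `ℂ[z]` is its own annihilator for the residue pairing. -/
lemma mem_range_of_resInfty {f : Kz} (hf : ∀ p : ℂ[X], resInfty (f * polyIncl p) = 0) :
    ∃ p, polyIncl p = f := by
  -- Pairing with `z^n` reads off the coefficient of `w^(n+1)`.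
  have h1 : ∀ n : ℕ, (expandInfty f).coeff (n + 1) = 0 := by
    intro n
    have h : -(expandInfty (f * polyIncl (X ^ n))).coeff 1 = 0 := hf (X ^ n)
    have hX : polyIncl (X ^ n) = (RatFunc.X : Kz) ^ n := by simp
    rw [hX, map_mul, map_pow, expandInfty_X, HahnSeries.single_pow, HahnSeries.coeff_mul_single,
      neg_eq_zero] at h
    simpa [add_comm] using h
  have hb : ∀ n : ℤ, n < (expandInfty f).order → (expandInfty f).coeff n = 0 :=
    fun n hn => HahnSeries.coeff_eq_zero_of_lt_order hn
  obtain ⟨K, hK⟩ : ∃ K : ℕ, -(expandInfty f).order < K :=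
    ⟨(-(expandInfty f).order + 1).toNat, by omega⟩
  -- Only finitely many exponents remain, all `≤ 0`, so the expansion of `f` is that of a polynomial
  -- in `z = w⁻¹`.
  refine ⟨∑ n ∈ Finset.range K, monomial n ((expandInfty f).coeff (-n)), ?_⟩
  apply expandInfty.injective
  rw [expandInfty_polyIncl]
  ext n
  rcases lt_or_ge 0 n with hn | hn
  · rw [polyExpand_coeff_pos _ hn]
    obtain ⟨m, rfl⟩ : ∃ m : ℕ, n = m + 1 := ⟨(n - 1).toNat, by omega⟩
    exact (h1 m).symm
  · obtain ⟨m, rfl⟩ : ∃ m : ℕ, n = -m := ⟨(-n).toNat, by omega⟩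
    rw [polyExpand_coeff, finsetSum_coeff]
    simp only [coeff_monomial]
    rw [Finset.sum_ite_eq']
    split_ifs with h
    · rfl
    · rw [hb]
      rw [Finset.mem_range] at h
      omega

/-- The Euler operator `w d/dw` on Laurent series. -/
def euler (f : LaurentSeries ℂ) : LaurentSeries ℂ where
  coeff n := n * f.coeff n
  isPWO_support' := f.isPWO_support.mono fun n hn h => hn (by simp [h])

lemma euler_coeff (f : LaurentSeries ℂ) (n : ℤ) : (euler f).coeff n = n * f.coeff n := rfl

lemma euler_add (f g : LaurentSeries ℂ) : euler (f + g) = euler f + euler g := by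
  ext n
  simp only [euler_coeff, HahnSeries.coeff_add, mul_add]

lemma euler_mul (f g : LaurentSeries ℂ) : euler (f * g) = euler f * g + f * euler g := by
  ext n
  -- The primed lemmas sum all three products over the same pairs of exponents, although `euler` may
  -- shrink supports; then `n = i + j` gives the Leibniz rule termwise.
  rw [HahnSeries.coeff_add, euler_coeff, HahnSeries.coeff_mul,
    HahnSeries.coeff_mul_left' (x := euler f) f.isPWO_support (fun n hn h => hn (by simp [euler_coeff, h])),
    HahnSeries.coeff_mul_right' (y := euler g) g.isPWO_support
      (fun n hn h => hn (by simp [euler_coeff, h])), Finset.mul_sum, ← Finset.sum_add_distrib]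
  refine Finset.sum_congr rfl fun ij hij => ?_
  obtain ⟨-, -, h⟩ := Finset.mem_antidiagonal.mp hij
  rw [euler_coeff, euler_coeff, ← h]
  push_cast
  ring

/-- For `w = 1/z` one has `z d/dz = -w d/dw`; the factor `z` makes the operator diagonal on
monomials. -/
lemma expandInfty_dz_poly (p : ℂ[X]) :
    expandInfty (RatFunc.X * dz (polyIncl p)) = -euler (expandInfty (polyIncl p)) := by
  induction p using Polynomial.induction_on' with
  | add p q hp hq => simp only [map_add, mul_add, hp, hq, euler_add, neg_add]
  | monomial i a =>
    have h : RatFunc.X * dz (polyIncl (monomial i a)) = ((i : ℂ) * a) • (RatFunc.X : Kz) ^ i := by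
      rw [dz_poly, derivative_monomial]
      cases i with
      | zero => simp
      | succ i =>
        rw [← C_mul_X_pow_eq_monomial, pow_succ']
        simp [Algebra.smul_def]
        ring
    have h2 : polyIncl (monomial i a) = a • (RatFunc.X : Kz) ^ i := by
      rw [← C_mul_X_pow_eq_monomial]; simp [Algebra.smul_def]
    rw [h, h2, expandInfty_smul, expandInfty_smul, map_pow, expandInfty_X, HahnSeries.single_pow]
    ext n
    rw [HahnSeries.coeff_neg, euler_coeff, HahnSeries.coeff_smul, HahnSeries.coeff_smul,
      HahnSeries.coeff_single]
    split_ifs with hn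
    · rw [hn]; simp
    · simp

/-- Both sides obey the Leibniz rule, so the polynomial case, applied to `num = f * denom`, passes
to quotients. -/
lemma expandInfty_dz (f : Kz) : expandInfty (RatFunc.X * dz f) = -euler (expandInfty f) := by
  have hd : polyIncl f.denom ≠ 0 := polyIncl_ne_zero f.denom_ne_zero
  have h1 : polyIncl f.num = f * polyIncl f.denom := by
    have h2 := num_div f
    rwa [div_eq_iff hd] at h2
  have h2 := expandInfty_dz_poly f.num
  rw [h1, Derivation.leibniz, map_mul expandInfty f, euler_mul, smul_eq_mul, smul_eq_mul] at h2
  have h3 : RatFunc.X * (f * dz (polyIncl f.denom) + polyIncl f.denom * dz f) =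
      f * (RatFunc.X * dz (polyIncl f.denom)) + (RatFunc.X * dz f) * polyIncl f.denom := by ring
  rw [h3, map_add, map_mul expandInfty f, expandInfty_dz_poly,
    map_mul expandInfty (RatFunc.X * dz f)] at h2
  have h4 : expandInfty (polyIncl f.denom) ≠ 0 := by
    rwa [Ne, map_eq_zero_iff _ expandInfty.injective]
  refine mul_right_cancel₀ h4 ?_
  linear_combination h2

/-- The residue at `∞` of an exact differential vanishes. -/
lemma resInfty_dz (f : Kz) : resInfty (dz f) = 0 := by
  -- The factor `z` moves the coefficient of `w` to that of `w^0`, which `w d/dw` kills.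
  have h := congrArg (fun g : LaurentSeries ℂ => g.coeff 0) (expandInfty_dz f)
  simp only [map_mul, expandInfty_X, HahnSeries.coeff_single_mul, HahnSeries.coeff_neg,
    euler_coeff] at h
  change -(expandInfty (dz f)).coeff 1 = 0
  simpa using h

lemma resInfty_dz_mul (f g : Kz) : resInfty (dz f * g) = -resInfty (f * dz g) := by
  have h := resInfty_dz (f * g)
  rw [Derivation.leibniz, smul_eq_mul, smul_eq_mul, map_add, mul_comm g] at h
  linear_combination h

lemma DOp.act_mul (P R : DOp) (f : Kz) : (P * R).act f = P.act (R.act f) := rfl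

/-- The formal adjoint is the adjoint for the residue pairing. -/
lemma resInfty_adjLin (P : DOp) (f g : Kz) :
    resInfty ((adjLin P).act f * g) = resInfty (f * P.act g) := by
  induction P using DOp_induction generalizing f g with
  | add P R hP hR =>
    simp only [map_add, LinearMap.add_apply, add_mul, mul_add, hP, hR]
  | term i a =>
    have hd : ∀ f g : Kz, resInfty (((-delD) ^ i).act f * g) = resInfty (f * (delD ^ i).act g) := by
      induction i with
      | zero => intro f g; rfl
      | succ i ih =>
        intro f g
        rw [pow_succ, pow_succ', DOp.act_mul, DOp.act_mul, ih]
        change resInfty (-(dz f) * _) = resInfty (f * dz _)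
        rw [neg_mul, map_neg, resInfty_dz_mul, neg_neg]
    rw [adjLin_term, DOp.act_mul, DOp.act_mul, hd]
    change resInfty (a * f * _) = resInfty (f * (a * _))
    congr 1
    ring

/-- The condition `res (P p · g) = 0` for all polynomials `p` and all `g ∈ W` says, after moving `P`
across, that the adjoint of `P` sends `g` into the annihilator of `ℂ[z]`, which is `ℂ[z]`. -/
lemma rIdeal_annih (W : Submodule ℂ Kz) : rIdeal (annih W) = cLeft (lIdeal W) := by
  ext q
  constructor
  · rintro ⟨P, hP, rfl⟩
    refine ⟨inclQ (adjLin P), ⟨adjLin P, fun f hf => ?_, rfl⟩, ?_⟩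
    · obtain ⟨p, hp⟩ := mem_range_of_resInfty (f := (adjLin P).act f) fun p => by
        rw [resInfty_adjLin, mul_comm]
        exact hP p f hf
      exact ⟨p, hp⟩
    · rw [c_inclQ, adjLin_adjLin]
  · rintro ⟨_, ⟨P, hP, rfl⟩, rfl⟩
    rw [c_inclQ]
    refine ⟨adjLin P, fun p g hg => ?_, rfl⟩
    obtain ⟨r, hr⟩ := hP g hg
    have hr' : polyIncl r = P.act g := hr
    rw [resInfty_adjLin, ← hr', ← map_mul]
    exact resInfty_polyIncl _

/-! ### Operators preserving `ℂ[z]`, units of `ℂ(z)[∂]` -/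

lemma act_coeffEquiv (p : Kz[X]) (f : Kz) :
    (coeffEquiv p).act f = ∑ i ∈ p.support, p.coeff i * (dOp ^ i) f := by
  change (p.sum fun i a => mulOp a * dOp ^ i) f = _
  rw [Polynomial.sum_def, LinearMap.sum_apply]
  rfl

/-- On `z^k` the terms of order above `k` vanish, those below are polynomial by induction, and the
term of order `k` is a non-zero multiple of its coefficient. -/
lemma coeff_mem_range_of_preserves {p : Kz[X]}
    (hp : ∀ r : ℂ[X], (coeffEquiv p).act (polyIncl r) ∈ polyIncl.range) (k : ℕ) :
    p.coeff k ∈ polyIncl.range := by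
  induction k using Nat.strong_induction_on with
  | _ k ih =>
    have hX : ∀ n, (RatFunc.X : Kz) ^ n = polyIncl (X ^ n) := by intro n; simp
    have h1 := hp (X ^ k)
    rw [act_coeffEquiv, ← hX] at h1
    by_cases hk : k ∈ p.support
    · rw [← Finset.add_sum_erase _ _ hk] at h1
      have h2 : ∑ i ∈ p.support.erase k, p.coeff i * (dOp ^ i) (RatFunc.X ^ k) ∈ polyIncl.range := by
        refine sum_mem fun i hi => ?_
        obtain ⟨c, -, h3, h4⟩ := dOp_pow_X_pow i k
        rw [h4]
        rcases lt_or_gt_of_ne (Finset.ne_of_mem_erase hi) with h | h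
        · exact mul_mem (ih i h) (polyIncl.range.smul_mem ⟨X ^ (k - i), (hX _).symm⟩ c)
        · rw [h3 h, zero_smul, mul_zero]
          exact zero_mem _
      have h5 := sub_mem h1 h2
      rw [add_sub_cancel_right] at h5
      obtain ⟨c, h6, -, h7⟩ := dOp_pow_X_pow k k
      rw [h7, Nat.sub_self, pow_zero, mul_smul_comm, mul_one] at h5
      have h8 := polyIncl.range.smul_mem h5 c⁻¹
      rwa [smul_smul, inv_mul_cancel₀ (h6 le_rfl), one_smul] at h8
    · rw [notMem_support_iff.mp hk]
      exact zero_mem _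

/-- The Weyl algebra consists of all operators in `ℂ(z)[∂]` that preserve `ℂ[z]`. -/
lemma mem_weyl_of_preserves {P : DOp}
    (hP : ∀ r : ℂ[X], P.act (polyIncl r) ∈ polyIncl.range) : inclQ P ∈ weyl := by
  obtain ⟨p, rfl⟩ := coeffEquiv.surjective P
  rw [← Polynomial.sum_monomial_eq p, Polynomial.sum_def, map_sum, map_sum]
  refine sum_mem fun i _ => ?_
  obtain ⟨a, ha⟩ := coeff_mem_range_of_preserves hP i
  have ha' : polyIncl a = p.coeff i := ha
  rw [coeffEquiv_monomial, ← ha', map_mul, map_pow]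
  exact mul_mem (poly_mem_weyl a) (pow_mem del_mem_weyl i)

/-- Leading coefficients multiply, so orders add; an invertible operator has order zero. -/
lemma exists_fnD_of_mul_eq_one {P R : DOp} (h : P * R = 1) : ∃ g : Kz, P = fnD g := by
  obtain ⟨p, rfl⟩ := coeffEquiv.surjective P
  obtain ⟨q, rfl⟩ := coeffEquiv.surjective R
  have h1 : starMul p q = monomial 0 1 := by
    apply coeffEquiv.injective
    rw [coeffEquiv_starMul, h, coeffEquiv_monomial, fnD_one, pow_zero, one_mul]
  have hp : p ≠ 0 := by rintro rfl; simp at h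
  have hq : q ≠ 0 := by rintro rfl; simp at h
  have h2 := (starMul_coeff p q le_rfl le_rfl).2
  have h3 : p.natDegree = 0 := by
    by_contra hne
    rw [h1, coeff_monomial, if_neg (by omega)] at h2
    exact mul_ne_zero (leadingCoeff_ne_zero.mpr hp) (leadingCoeff_ne_zero.mpr hq) h2.symm
  refine ⟨p.coeff 0, ?_⟩
  conv_lhs => rw [eq_C_of_natDegree_eq_zero h3]
  have := coeffEquiv_monomial 0 (p.coeff 0)
  rwa [pow_zero, mul_one] at this

lemma fnD_ne_zero {f : Kz} (hf : f ≠ 0) : fnD f ≠ 0 := by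
  intro h
  have h2 : f * 1 = 0 := congrArg (fun P : DOp => P.act 1) h
  exact hf (by simpa using h2)

lemma inclQ_fnD_inv (f : Kz) (hf : f ≠ 0) : (inclQ (fnD f))⁻¹ = inclQ (fnD f⁻¹) := by
  refine inv_eq_of_mul_eq_one_right ?_
  rw [← map_mul, ← fnD_mul, mul_inv_cancel₀ hf, fnD_one, map_one]

/-- Applied with functions lying in `R_W`, this brings elements of `Q` back into `ℂ(z)[∂]`. -/
lemma mem_range_inclQ_of_mul {q : Q} {f : Kz} (hf : f ≠ 0) {P : DOp}
    (h : q * inclQ (fnD f) = inclQ P) : ∃ R : DOp, q = inclQ R := by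
  refine ⟨P * fnD f⁻¹, ?_⟩
  rw [map_mul, ← h, ← inclQ_fnD_inv f hf, mul_inv_cancel_right₀]
  rw [Ne, map_eq_zero_iff _ inclQ_injective]
  exact fnD_ne_zero hf

/-- For every `M` some operator fixes `1` and maps each polynomial to a constant
modulo `(z - l)^M`. -/
lemma exists_constant_mod_pow (l : ℂ) (M : ℕ) : ∃ P : DOp, P.act 1 = 1 ∧
    ∀ p : ℂ[X], ∃ (a : ℂ) (g : ℂ[X]), P.act (polyIncl p) = polyIncl (C a + (X - C l) ^ M * g) := by
  induction M with
  | zero => exact ⟨1, rfl, fun p => ⟨0, p, by simp⟩⟩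
  | succ M ih =>
    -- The first step needs no correction, since `p - p(l)` is divisible by `z - l`; the factor used
    -- below involves `M⁻¹`.
    rcases Nat.eq_zero_or_pos M with rfl | hM
    · refine ⟨1, rfl, fun p => ⟨p.eval l, p /ₘ (X - C l), ?_⟩⟩
      rw [zero_add, pow_one, ← modByMonic_X_sub_C_eq_C_eval, modByMonic_add_div]
      simp
    obtain ⟨P, h1, h2⟩ := ih
    -- Since `(z - l)∂` acts on `(z - l)^M` by the factor `M`, this operator kills the Taylor term
    -- of order `M` and fixes constants.
    refine ⟨(1 - (M : ℂ)⁻¹ • (fnD (polyIncl (X - C l)) * delD)) * P, ?_, fun p => ?_⟩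
    · rw [DOp.act_mul, h1]
      change (1 : Kz) - (M : ℂ)⁻¹ • (polyIncl (X - C l) * dz 1) = 1
      simp
    · obtain ⟨a, g, h⟩ := h2 p
      have hM0 : (M : ℂ) ≠ 0 := by exact_mod_cast hM.ne'
      refine ⟨a, C (-(M : ℂ)⁻¹) * derivative g, ?_⟩
      rw [DOp.act_mul, h]
      change polyIncl _ - (M : ℂ)⁻¹ • (polyIncl (X - C l) * dz (polyIncl _)) = _
      rw [dz_poly, ← map_mul, ← map_smul, ← map_sub]
      congr 1
      obtain ⟨m, rfl⟩ : ∃ m, M = m + 1 := ⟨M - 1, by omega⟩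
      rw [smul_eq_C_mul]
      have hC : C ((m + 1 : ℕ) : ℂ)⁻¹ * C ((m + 1 : ℕ) : ℂ) = 1 := by
        rw [← C_mul, inv_mul_cancel₀ hM0, C_1]
      simp only [derivative_add, derivative_mul, derivative_C, derivative_X_sub_C_pow,
        Nat.add_sub_cancel, map_neg]
      simp only [pow_succ, Nat.cast_add, Nat.cast_one] at hC ⊢
      linear_combination (-(X - C l) ^ m * (X - C l) * g) * hC

/-! ### Isomorphisms between right `A₁`-submodules of `Q` -/

/-- Left multiplication by `q` on `Q`, as a homomorphism of right `A₁`-modules. -/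
def lmulQ (q : Q) : Q →ₗ[weyl.op] Q where
  toFun x := q * x
  map_add' := mul_add q
  map_smul' a x := (mul_assoc q x (a : Qᵐᵒᵖ).unop).symm

lemma lmulQ_apply (q x : Q) : lmulQ q x = q * x := rfl

lemma mul_mem_right (I : RightSub) {i a : Q} (hi : i ∈ I) (ha : a ∈ weyl) : i * a ∈ I :=
  I.smul_mem ⟨MulOpposite.op a, ha⟩ hi

/-- Right fractions come from left ones by applying `c`. -/
lemma exists_right_weyl_fraction (q : Q) : ∃ a ∈ weyl, ∃ s ∈ weyl, s ≠ 0 ∧ q * s = a := by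
  obtain ⟨a, ha, s, hs, hs0, h⟩ := exists_weyl_fraction (c q)
  refine ⟨c a, c_mem_weyl ha, c s, c_mem_weyl hs, ?_, ?_⟩
  · intro h0
    apply hs0
    rw [← c_c s, h0, c_zero]
  · rw [← c_c q, ← c_mul, h, mul_inv_cancel_left₀ hs0]

/-- Isomorphic right `A₁`-submodules of `Q` differ by left multiplication by an element of `Q`. -/
lemma exists_eq_map_lmulQ {I J : RightSub} (hI : I ≠ ⊥) (e : I ≃ₗ[weyl.op] J) :
    ∃ q : Q, q ≠ 0 ∧ J = I.map (lmulQ q) := by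
  obtain ⟨i₀, hi₀, hne⟩ := I.ne_bot_iff.mp hI
  set q : Q := (e ⟨i₀, hi₀⟩ : Q) * i₀⁻¹ with hq
  have hmul : ∀ (i a : Q) (hi : i ∈ I) (ha : a ∈ weyl),
      (e ⟨i * a, mul_mem_right I hi ha⟩ : Q) = e ⟨i, hi⟩ * a := by
    intro i a hi ha
    exact congrArg Subtype.val (e.map_smul ⟨MulOpposite.op a, ha⟩ ⟨i, hi⟩)
  have key : ∀ i (hi : i ∈ I), (e ⟨i, hi⟩ : Q) = q * i := by
    intro i hi
    -- A common right multiple `i s = i₀ a` transfers the value of `e` from `i₀` to `i` by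
    -- `A₁`-linearity.
    obtain ⟨a, ha, s, hs, hs0, h⟩ := exists_right_weyl_fraction (i₀⁻¹ * i)
    have h1 : i * s = i₀ * a := by
      rw [← h, mul_assoc, mul_inv_cancel_left₀ hne]
    have h2 := hmul i s hi hs
    have h3 := hmul i₀ a hi₀ ha
    have h4 : (e ⟨i * s, mul_mem_right I hi hs⟩ : Q) = e ⟨i₀ * a, mul_mem_right I hi₀ ha⟩ := by
      congr 2
      exact Subtype.ext h1
    rw [h2, h3] at h4
    refine mul_right_cancel₀ hs0 ?_
    rw [h4, mul_assoc q, h1, hq, mul_assoc, inv_mul_cancel_left₀ hne]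
  refine ⟨q, ?_, ?_⟩
  · intro h0
    have h1 := key i₀ hi₀
    rw [h0, zero_mul] at h1
    have h2 : e ⟨i₀, hi₀⟩ = 0 := Subtype.ext h1
    rw [LinearEquiv.map_eq_zero_iff] at h2
    exact hne (congrArg Subtype.val h2)
  · ext x
    constructor
    · intro hx
      refine ⟨e.symm ⟨x, hx⟩, Subtype.property _, ?_⟩
      rw [lmulQ_apply, ← key _ (Subtype.property _)]
      simp
    · rintro ⟨i, hi, rfl⟩
      rw [lmulQ_apply, ← key i hi]
      exact Subtype.property _

lemma nonempty_equiv_map_lmulQ (I : RightSub) {q : Q} (hq : q ≠ 0) :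
    Nonempty (I ≃ₗ[weyl.op] I.map (lmulQ q)) :=
  ⟨Submodule.equivMapOfInjective (lmulQ q) (fun _ _ h => mul_left_cancel₀ hq h) I⟩

lemma isoClass_congr {F G : RightSub} (h : Nonempty (F ≃ₗ[weyl.op] G)) :
    isoClass F = isoClass G := by
  obtain ⟨e⟩ := h
  ext I
  exact and_congr_right fun _ => ⟨fun ⟨f⟩ => ⟨f.trans e⟩, fun ⟨f⟩ => ⟨f.trans e.symm⟩⟩

/-- Since `c(qI) = c(I) c(q)`, the duals of `c(I)` and `c(qI)` differ by left multiplication by `c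
q`; so the class of the dual depends only on that of `I`. -/
lemma dualRight_cRight_map {I : RightSub} {q : Q} (hq : q ≠ 0) :
    dualRight (cRight I) = (dualRight (cRight (I.map (lmulQ q)))).map (lmulQ (c q)) := by
  have hcq : c q ≠ 0 := by
    intro h
    apply hq
    rw [← c_c q, h, c_zero]
  ext x
  constructor
  · intro hx
    refine ⟨(c q)⁻¹ * x, ?_, mul_inv_cancel_left₀ hcq x⟩
    rintro _ ⟨_, ⟨i, hi, rfl⟩, rfl⟩
    rw [lmulQ_apply, c_mul, mul_assoc, mul_inv_cancel_left₀ hcq]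
    exact hx _ ⟨i, hi, rfl⟩
  · rintro ⟨y, hy, rfl⟩
    rintro _ ⟨i, hi, rfl⟩
    rw [lmulQ_apply, ← mul_assoc, ← c_mul]
    exact hy _ ⟨q * i, ⟨i, hi, rfl⟩, rfl⟩

/-- The class `c ⋆ [F]` can be computed from the fractional ideal `F` itself. -/
lemma cStar_isoClass {F : RightSub} (h : (isoClass F).Nonempty) :
    cStar (isoClass F) = isoClass (dualRight (cRight F)) := by
  have key : ∀ I ∈ isoClass F, isoClass (dualRight (cRight I)) = isoClass (dualRight (cRight F)) := by
    rintro I ⟨hI, ⟨e⟩⟩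
    obtain ⟨q, hq, rfl⟩ := exists_eq_map_lmulQ hI.1 e
    have hcq : c q ≠ 0 := by
      intro h
      apply hq
      rw [← c_c q, h, c_zero]
    rw [dualRight_cRight_map (I := I) hq]
    exact (isoClass_congr (nonempty_equiv_map_lmulQ _ hcq)).symm
  -- `cStar` is a union over the members of the class and would be empty without one.
  obtain ⟨I, hI⟩ := h
  ext J
  simp only [cStar, Set.mem_iUnion]
  constructor
  · rintro ⟨I, hI, hJ⟩
    rwa [key I hI] at hJ
  · intro hJ
    exact ⟨I, hI, by rwa [key I hI]⟩

/-! ### Codimensions in `ℂ[z]` -/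

/-- The space `p ℂ[z]` of multiples of `p`. -/
def multiples (p : ℂ[X]) : Submodule ℂ ℂ[X] := (Ideal.span {p}).restrictScalars ℂ

lemma mem_multiples {p f : ℂ[X]} : f ∈ multiples p ↔ p ∣ f := Ideal.mem_span_singleton

lemma finite_quotient_restrictScalars (I : Ideal ℂ[X]) [h : Module.Finite ℂ (ℂ[X] ⧸ I)] :
    Module.Finite ℂ (ℂ[X] ⧸ I.restrictScalars ℂ) := by
  have e := (Submodule.Quotient.restrictScalarsEquiv ℂ I).symm
  exact Module.Finite.equiv e

lemma finite_quotient_of_multiples_le {l : ℂ} {M : ℕ} {V : Submodule ℂ ℂ[X]}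
    (hV : multiples ((X - C l) ^ M) ≤ V) : Module.Finite ℂ (ℂ[X] ⧸ V) := by
  have h1 : Module.Finite ℂ (ℂ[X] ⧸ Ideal.span {(X - C l) ^ M}) :=
    ((monic_X_sub_C l).pow M).finite_quotient
  have h2 : Module.Finite ℂ (ℂ[X] ⧸ multiples ((X - C l) ^ M)) :=
    finite_quotient_restrictScalars _
  exact Module.Finite.of_surjective (Submodule.factor hV) (Submodule.factor_surjective hV)

lemma finrank_quotient_multiples (l : ℂ) (M : ℕ) :
    Module.finrank ℂ (ℂ[X] ⧸ multiples ((X - C l) ^ M)) = M := by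
  have h := (Submodule.Quotient.restrictScalarsEquiv ℂ (Ideal.span {(X - C l) ^ M})).finrank_eq
  rw [finrank_quotient_span_eq_natDegree, natDegree_pow, natDegree_X_sub_C, mul_one] at h
  exact h

lemma finrank_quotient_map {K E F : Type*} [Field K] [AddCommGroup E] [AddCommGroup F]
    [Module K E] [Module K F] (f : E →ₗ[K] F) (hf : Function.Surjective f) (V : Submodule K E)
    (hV : LinearMap.ker f ≤ V) :
    Module.finrank K (F ⧸ V.map f) = Module.finrank K (E ⧸ V) := by
  have hk : LinearMap.ker ((V.map f).mkQ ∘ₗ f) = V := by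
    rw [LinearMap.ker_comp, Submodule.ker_mkQ, Submodule.comap_map_eq, sup_eq_left.mpr hV]
  have h := (((V.map f).mkQ ∘ₗ f).quotKerEquivOfSurjective
    ((Submodule.mkQ_surjective _).comp hf)).finrank_eq
  rw [← h, hk]

lemma isCoprime_X_sub_C {l m : ℂ} (h : l ≠ m) : IsCoprime (X - C l) (X - C m) :=
  isCoprime_X_sub_C_of_isUnit_sub (sub_ne_zero.mpr h).isUnit

/-- Multiplication by a polynomial increases the codimension of a primary subspace by the order of
vanishing. -/
lemma finrank_quotient_mul {l : ℂ} {j r M : ℕ} {u : ℂ[X]} {V : Submodule ℂ ℂ[X]}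
    (hu : IsCoprime (X - C l) u) (hV : multiples ((X - C l) ^ r) ≤ V) (hM : r + j ≤ M) :
    Module.finrank ℂ (ℂ[X] ⧸ (V.map (LinearMap.mulLeft ℂ ((X - C l) ^ j * u)) ⊔
      multiples ((X - C l) ^ M))) = Module.finrank ℂ (ℂ[X] ⧸ V) + j := by
  set q := (X - C l) ^ j * u with hq
  set V' := V.map (LinearMap.mulLeft ℂ q) ⊔ multiples ((X - C l) ^ M) with hV'
  have hfin : Module.Finite ℂ (ℂ[X] ⧸ V') := finite_quotient_of_multiples_le le_sup_right
  have ht : (X - C l : ℂ[X]) ≠ 0 := X_sub_C_ne_zero l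
  -- The kernel of `φ` is `V` and its image is that of `(z - l)^j ℂ[z]`; the cokernel has dimension
  -- `j`.
  set φ : ℂ[X] →ₗ[ℂ] ℂ[X] ⧸ V' := V'.mkQ ∘ₗ LinearMap.mulLeft ℂ q with hφ
  have hker : LinearMap.ker φ = V := by
    ext f
    rw [LinearMap.mem_ker]
    change V'.mkQ (q * f) = 0 ↔ _
    rw [Submodule.mkQ_apply, Submodule.Quotient.mk_eq_zero]
    constructor
    · intro h
      obtain ⟨_, ⟨v, hv, rfl⟩, g, hg, h⟩ := Submodule.mem_sup.mp h
      change q * v + g = q * f at h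
      rw [mem_multiples] at hg
      have h1 : g = (X - C l) ^ j * (u * (f - v)) := by rw [hq] at h; linear_combination h
      have h2 : (X - C l) ^ (j + r) ∣ (X - C l) ^ j * (u * (f - v)) :=
        h1 ▸ (pow_dvd_pow _ (by omega)).trans hg
      rw [pow_add, mul_dvd_mul_iff_left (pow_ne_zero _ ht)] at h2
      have h3 := (hu.pow_left (m := r)).dvd_of_dvd_mul_left h2
      have h4 := V.add_mem (hV (mem_multiples.mpr h3)) hv
      rwa [sub_add_cancel] at h4
    · intro hf
      exact Submodule.mem_sup_left ⟨f, hf, rfl⟩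
  have hle : V' ≤ multiples ((X - C l) ^ j) := by
    refine sup_le ?_ ?_
    · rintro _ ⟨v, -, rfl⟩
      exact mem_multiples.mpr ⟨u * v, by rw [LinearMap.mulLeft_apply, hq, mul_assoc]⟩
    · intro f hf
      exact mem_multiples.mpr ((pow_dvd_pow _ (by omega)).trans (mem_multiples.mp hf))
  have hrange : LinearMap.range φ = (multiples ((X - C l) ^ j)).map V'.mkQ := by
    ext x
    constructor
    · rintro ⟨f, rfl⟩
      exact ⟨q * f, mem_multiples.mpr ⟨u * f, by rw [hq, mul_assoc]⟩, rfl⟩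
    · rintro ⟨f, hf, rfl⟩
      obtain ⟨g, rfl⟩ := mem_multiples.mp hf
      -- Here `b` is an inverse of `u` modulo `(z - l)^M`.
      obtain ⟨a, b, hab⟩ := hu.pow_left (m := M)
      refine ⟨b * g, ?_⟩
      change V'.mkQ (q * (b * g)) = V'.mkQ _
      rw [← sub_eq_zero, ← map_sub, Submodule.mkQ_apply, Submodule.Quotient.mk_eq_zero]
      refine Submodule.mem_sup_right (mem_multiples.mpr ⟨-((X - C l) ^ j * a * g), ?_⟩)
      rw [hq]
      linear_combination ((X - C l) ^ j * g) * hab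
  have h1 := Submodule.finrank_quotient_add_finrank (LinearMap.range φ)
  have h2 := φ.quotKerEquivRange.finrank_eq
  rw [hker] at h2
  rw [← h2, hrange, finrank_quotient_map V'.mkQ V'.mkQ_surjective _ (by rwa [Submodule.ker_mkQ]),
    finrank_quotient_multiples] at h1
  omega

/-- Codimensions of subspaces orthogonal for a non-degenerate form `(f, g) ↦ ρ (f g)` on
`ℂ[z] / (z - l)^M`. -/
lemma finrank_quotient_orthogonal {l : ℂ} {M : ℕ} (ρ : ℂ[X] →ₗ[ℂ] ℂ)
    (h0 : ∀ g, ρ ((X - C l) ^ M * g) = 0)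
    (hnd : ∀ f, (∀ g, ρ (f * g) = 0) → (X - C l) ^ M ∣ f) {V V' : Submodule ℂ ℂ[X]}
    (hV : multiples ((X - C l) ^ M) ≤ V) (hV' : ∀ f, f ∈ V' ↔ ∀ v ∈ V, ρ (f * v) = 0) :
    Module.finrank ℂ (ℂ[X] ⧸ V) + Module.finrank ℂ (ℂ[X] ⧸ V') = M := by
  set I : Ideal ℂ[X] := Ideal.span {(X - C l) ^ M} with hI
  have hfin : Module.Finite ℂ (ℂ[X] ⧸ I) := ((monic_X_sub_C l).pow M).finite_quotient
  have hdim : Module.finrank ℂ (ℂ[X] ⧸ I) = M := by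
    rw [hI, finrank_quotient_span_eq_natDegree, natDegree_pow, natDegree_X_sub_C, mul_one]
  set π : ℂ[X] →ₗ[ℂ] ℂ[X] ⧸ I := (Ideal.Quotient.mkₐ ℂ I).toLinearMap with hπ
  have hπs : Function.Surjective π := Ideal.Quotient.mk_surjective
  have hπk : LinearMap.ker π = multiples ((X - C l) ^ M) := by
    ext f
    rw [LinearMap.mem_ker]
    exact Ideal.Quotient.eq_zero_iff_mem
  set ρ' : (ℂ[X] ⧸ I) →ₗ[ℂ] ℂ := ((multiples ((X - C l) ^ M)).liftQ ρ (by
    intro f hf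
    obtain ⟨g, rfl⟩ := mem_multiples.mp hf
    exact h0 g)) ∘ₗ (Submodule.Quotient.restrictScalarsEquiv ℂ I).symm.toLinearMap with hρ'
  have hρπ : ∀ f, ρ' (π f) = ρ f := fun f => rfl
  set B : LinearMap.BilinForm ℂ (ℂ[X] ⧸ I) := (LinearMap.mul ℂ (ℂ[X] ⧸ I)).compr₂ ρ' with hB
  have hBπ : ∀ f g, B (π f) (π g) = ρ (f * g) := fun f g => rfl
  have hV'le : multiples ((X - C l) ^ M) ≤ V' := by
    intro f hf
    obtain ⟨g, rfl⟩ := mem_multiples.mp hf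
    refine (hV' _).mpr fun v _ => ?_
    rw [mul_assoc]
    exact h0 _
  have hnondeg : B.Nondegenerate := by
    have hs : ∀ x, (∀ y, B x y = 0) → x = 0 := by
      intro x hx
      obtain ⟨f, rfl⟩ := hπs x
      have := hnd f fun g => by rw [← hBπ]; exact hx _
      rw [← LinearMap.mem_ker, hπk]
      exact mem_multiples.mpr this
    refine ⟨hs, fun y hy => hs y fun x => ?_⟩
    rw [← hy x]
    change ρ' (y * x) = ρ' (x * y)
    rw [mul_comm]
  have horth : B.orthogonal (V.map π) = V'.map π := by
    ext x
    obtain ⟨f, rfl⟩ := hπs x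
    have h1 : π f ∈ V'.map π ↔ f ∈ V' := by
      rw [← Submodule.mem_comap, Submodule.comap_map_eq, hπk, sup_eq_left.mpr hV'le]
    rw [h1, hV', LinearMap.BilinForm.mem_orthogonal_iff]
    constructor
    · intro h v hv
      rw [mul_comm]
      exact h (π v) ⟨v, hv, rfl⟩
    · rintro h _ ⟨v, hv, rfl⟩
      change ρ (v * f) = 0
      rw [mul_comm]
      exact h v hv
  -- Both spaces contain the multiples of `(z - l)^M`, so their codimensions can be computed in the
  -- `M`-dimensional quotient, where they are orthogonal complements.
  have h1 := LinearMap.BilinForm.finrank_orthogonal hnondeg (V.map π)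
  have h2 := Submodule.finrank_quotient_add_finrank (V.map π)
  have h3 := Submodule.finrank_quotient_add_finrank (V'.map π)
  rw [finrank_quotient_map π hπs V (hπk ▸ hV)] at h2
  rw [finrank_quotient_map π hπs V' (hπk ▸ hV'le)] at h3
  rw [horth] at h1
  omega

/-! ### Localization at finitely many points -/

/-- The polynomial `∏ (z - l)`, `l ∈ S`. -/
def ptsPoly (S : Finset ℂ) : ℂ[X] := ∏ l ∈ S, (X - C l)

lemma ptsPoly_ne_zero (S : Finset ℂ) : ptsPoly S ≠ 0 :=
  Finset.prod_ne_zero_iff.mpr fun l _ => X_sub_C_ne_zero l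

lemma polyIncl_ptsPoly_pow_ne_zero (S : Finset ℂ) (N : ℕ) : polyIncl (ptsPoly S ^ N) ≠ 0 :=
  polyIncl_ne_zero (pow_ne_zero _ (ptsPoly_ne_zero S))

lemma X_sub_C_dvd_ptsPoly {S : Finset ℂ} {l : ℂ} (hl : l ∈ S) : X - C l ∣ ptsPoly S :=
  Finset.dvd_prod_of_mem _ hl

lemma ptsPoly_pow_dvd {S : Finset ℂ} {K : ℕ} {f : ℂ[X]} (h : ∀ l ∈ S, (X - C l) ^ K ∣ f) :
    ptsPoly S ^ K ∣ f := by
  rw [ptsPoly, ← Finset.prod_pow]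
  exact Finset.prod_dvd_of_coprime
    (fun l _ m _ hlm => (isCoprime_X_sub_C hlm).pow) h

/-- `e` is constant to order `K` at each point of `S`. -/
def LocConst (S : Finset ℂ) (K : ℕ) (e : ℂ[X]) : Prop :=
  ∀ l ∈ S, ∃ a : ℂ, (X - C l) ^ K ∣ e - C a

/-- A polynomial which is `1` to order `K` at `l` and vanishes to order `K` at the other
points of `S`. -/
lemma exists_idempotent {S : Finset ℂ} {l : ℂ} (K : ℕ) : ∃ e : ℂ[X],
    (X - C l) ^ K ∣ e - 1 ∧ ∀ m ∈ S, m ≠ l → (X - C m) ^ K ∣ e := by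
  have hc : IsCoprime ((X - C l) ^ K) (∏ m ∈ S.erase l, (X - C m) ^ K) :=
    IsCoprime.prod_right fun m hm => (isCoprime_X_sub_C (Finset.ne_of_mem_erase hm).symm).pow
  obtain ⟨a, b, h⟩ := hc
  refine ⟨b * ∏ m ∈ S.erase l, (X - C m) ^ K, ⟨-a, by linear_combination h⟩, fun m hm hml => ?_⟩
  exact (Finset.dvd_prod_of_mem (fun m => (X - C m) ^ K) (Finset.mem_erase.mpr ⟨hml, hm⟩)).mul_left b

section idempotents

variable {S : Finset ℂ} {K : ℕ} {l : ℂ} {e : ℂ[X]}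

lemma locConst_idempotent (h1 : (X - C l) ^ K ∣ e - 1)
    (h2 : ∀ m ∈ S, m ≠ l → (X - C m) ^ K ∣ e) : LocConst S K e := by
  intro m hm
  by_cases h : m = l
  · exact ⟨1, by rw [h, C_1]; exact h1⟩
  · exact ⟨0, by rw [C_0, sub_zero]; exact h2 m hm h⟩

lemma ptsPoly_pow_dvd_mul_idempotent (h2 : ∀ m ∈ S, m ≠ l → (X - C m) ^ K ∣ e) :
    ptsPoly S ^ K ∣ (X - C l) ^ K * e := by
  refine ptsPoly_pow_dvd fun m hm => ?_
  by_cases h : m = l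
  · rw [h]; exact dvd_mul_right _ _
  · exact (h2 m hm h).mul_left _

end idempotents

/-- If `e l` is `1` at `l` and vanishes at the other points, then `∑ e l` is `1`. -/
lemma ptsPoly_pow_dvd_sum_sub_one {S : Finset ℂ} {K : ℕ} {e : ℂ → ℂ[X]}
    (h1 : ∀ l, (X - C l) ^ K ∣ e l - 1)
    (h2 : ∀ l, ∀ m ∈ S, m ≠ l → (X - C m) ^ K ∣ e l) :
    ptsPoly S ^ K ∣ ∑ l ∈ S, e l - 1 := by
  refine ptsPoly_pow_dvd fun m hm => ?_
  rw [← Finset.add_sum_erase _ _ hm, add_sub_right_comm]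
  exact dvd_add (h1 m) (Finset.dvd_sum fun l hl => h2 l m hm (Finset.ne_of_mem_erase hl).symm)

/-- The space `(∏ (z - l))^N W ∩ ℂ[z]`. -/
def clearDenom (S : Finset ℂ) (N : ℕ) (W : Submodule ℂ Kz) : Submodule ℂ ℂ[X] :=
  W.comap ((mulOp (polyIncl (ptsPoly S ^ N))⁻¹) ∘ₗ polyIncl.toLinearMap)

lemma mem_clearDenom {S : Finset ℂ} {N : ℕ} {W : Submodule ℂ Kz} {p : ℂ[X]} :
    p ∈ clearDenom S N W ↔ (polyIncl (ptsPoly S ^ N))⁻¹ * polyIncl p ∈ W := Iff.rfl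

/-- `W` lies in the adelic Grassmannian, with singularities in `S` and of order at most `N`. -/
structure NormalAt (S : Finset ℂ) (N : ℕ) (W : Submodule ℂ Kz) : Prop where
  le : ∀ f ∈ W, ∃ p : ℂ[X], polyIncl (ptsPoly S ^ N) * f = polyIncl p
  ge : ∀ p : ℂ[X], polyIncl (ptsPoly S ^ N * p) ∈ W
  stable : ∀ e : ℂ[X], LocConst S (2 * N) e → ∀ f ∈ W, polyIncl e * f ∈ W
  codim : ∀ l ∈ S, Module.finrank ℂ
    (ℂ[X] ⧸ (clearDenom S N W ⊔ multiples ((X - C l) ^ (2 * N)))) = N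

namespace NormalAt

variable {S : Finset ℂ} {N : ℕ} {W : Submodule ℂ Kz}

lemma mem_clearDenom_of_dvd (h : NormalAt S N W) {p : ℂ[X]} (hp : ptsPoly S ^ (2 * N) ∣ p) :
    p ∈ clearDenom S N W := by
  obtain ⟨g, rfl⟩ := hp
  have h1 := h.ge g
  rw [mem_clearDenom]
  convert! h1 using 1
  rw [two_mul, pow_add, mul_assoc, map_mul, inv_mul_cancel_left₀ (polyIncl_ptsPoly_pow_ne_zero S N)]

lemma mul_mem_clearDenom (h : NormalAt S N W) {e p : ℂ[X]} (he : LocConst S (2 * N) e)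
    (hp : p ∈ clearDenom S N W) : e * p ∈ clearDenom S N W := by
  have h1 := h.stable e he _ hp
  rw [mem_clearDenom, map_mul]
  convert! h1 using 1
  change _ = _ * (_ * polyIncl p)
  ring

lemma exists_clearDenom (h : NormalAt S N W) {f : Kz} (hf : f ∈ W) :
    ∃ p ∈ clearDenom S N W, f = (polyIncl (ptsPoly S ^ N))⁻¹ * polyIncl p := by
  obtain ⟨p, hp⟩ := h.le f hf
  have h1 : f = (polyIncl (ptsPoly S ^ N))⁻¹ * polyIncl p := by
    rw [← hp, inv_mul_cancel_left₀ (polyIncl_ptsPoly_pow_ne_zero S N)]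
  exact ⟨p, by rw [mem_clearDenom, ← h1]; exact hf, h1⟩

/-- Passage from local to global: `e` turns the ambiguity modulo `(z - l)^(2N)` into a multiple of
`P^(2N)`, which already lies in `P^N W`. -/
lemma idempotent_mul_mem (h : NormalAt S N W) {l : ℂ} {e p : ℂ[X]}
    (h1 : (X - C l) ^ (2 * N) ∣ e - 1) (h2 : ∀ m ∈ S, m ≠ l → (X - C m) ^ (2 * N) ∣ e)
    (hp : p ∈ clearDenom S N W ⊔ multiples ((X - C l) ^ (2 * N))) :
    e * p ∈ clearDenom S N W := by
  obtain ⟨v, hv, g, hg, rfl⟩ := Submodule.mem_sup.mp hp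
  obtain ⟨r, rfl⟩ := mem_multiples.mp hg
  rw [mul_add]
  refine add_mem (h.mul_mem_clearDenom (locConst_idempotent h1 h2) hv) (h.mem_clearDenom_of_dvd ?_)
  rw [← mul_assoc, mul_comm e]
  exact (ptsPoly_pow_dvd_mul_idempotent h2).mul_right r

/-- Partition of unity: modulo `P^(2N)`, `p` is the sum of its localizations `e l * p`. -/
lemma iInf_clearDenom (h : NormalAt S N W) :
    ⨅ l ∈ S, (clearDenom S N W ⊔ multiples ((X - C l) ^ (2 * N))) = clearDenom S N W := by
  refine le_antisymm (fun p hp => ?_) (le_iInf₂ fun l _ => le_sup_left)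
  rw [Submodule.mem_iInf] at hp
  choose e h1 h2 using fun l => exists_idempotent (S := S) (l := l) (2 * N)
  obtain ⟨g, hg⟩ := ptsPoly_pow_dvd_sum_sub_one h1 h2
  have h3 : p = (∑ l ∈ S, e l * p) - ptsPoly S ^ (2 * N) * (g * p) := by
    rw [← Finset.sum_mul]
    linear_combination (-p) * hg
  rw [h3]
  refine sub_mem (sum_mem fun l hl => ?_) (h.mem_clearDenom_of_dvd (dvd_mul_right _ _))
  exact h.idempotent_mul_mem (h1 l) (h2 l) ((Submodule.mem_iInf _).mp (hp l) hl)

/-- The local spaces at `l ∈ S` are primary of codimension exactly `N`, so the prescribed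
denominator is `P^N`. -/
lemma mem_Gr (h : NormalAt S N W) : W ∈ Gr := by
  refine ⟨S, fun l => clearDenom S N W ⊔ multiples ((X - C l) ^ (2 * N)), fun l _ => ⟨2 * N, fun p =>
    Submodule.mem_sup_right (mem_multiples.mpr (dvd_mul_right _ _))⟩, ?_⟩
  have h1 : adPoly S (fun l => clearDenom S N W ⊔ multiples ((X - C l) ^ (2 * N))) =
      ptsPoly S ^ N := by
    rw [adPoly, ptsPoly, ← Finset.prod_pow]
    exact Finset.prod_congr rfl fun l hl => by rw [h.codim l hl]
  rw [h1, h.iInf_clearDenom]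
  ext f
  constructor
  · intro hf
    obtain ⟨p, hp, rfl⟩ := h.exists_clearDenom hf
    exact ⟨_, ⟨p, hp, rfl⟩, rfl⟩
  · rintro ⟨_, ⟨p, hp, rfl⟩, rfl⟩
    exact hp

/-- The annihilator of a point of the adelic Grassmannian is again one. -/
lemma annih (h : NormalAt S N W) : NormalAt S N (annih W) := by
  have hP := polyIncl_ptsPoly_pow_ne_zero S N
  have hle : ∀ f ∈ AdelicGr.annih W, ∃ p : ℂ[X], polyIncl (ptsPoly S ^ N) * f = polyIncl p := by
    intro f hf
    obtain ⟨p, hp⟩ := mem_range_of_resInfty (f := polyIncl (ptsPoly S ^ N) * f) fun p => by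
      rw [mul_comm _ f, mul_assoc, ← map_mul]
      exact hf _ (h.ge p)
    exact ⟨p, hp.symm⟩
  have hge : ∀ p : ℂ[X], polyIncl (ptsPoly S ^ N * p) ∈ AdelicGr.annih W := by
    intro p f hf
    obtain ⟨r, hr⟩ := h.le f hf
    rw [mul_comm _ p, map_mul polyIncl, mul_assoc, hr, ← map_mul]
    exact resInfty_polyIncl _
  have hst : ∀ e : ℂ[X], LocConst S (2 * N) e → ∀ f ∈ AdelicGr.annih W,
      polyIncl e * f ∈ AdelicGr.annih W := by
    intro e he f hf g hg
    rw [mul_comm _ f, mul_assoc]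
    exact hf _ (h.stable e he g hg)
  refine ⟨hle, hge, hst, fun l hl => ?_⟩
  obtain ⟨e, h1, h2⟩ := exists_idempotent (S := S) (l := l) (2 * N)
  set a := (polyIncl (ptsPoly S ^ N))⁻¹ with ha
  have haP : ∀ f : ℂ[X], a * a * polyIncl (ptsPoly S ^ (2 * N) * f) = polyIncl f := by
    intro f
    rw [map_mul, two_mul, pow_add, map_mul, ha]
    field_simp
  -- This is `f ↦ res (e f / P^(2N))`: the factor `e` isolates the point `l`, and `P^(-2N)` comes
  -- from clearing `P^N` in each of the two arguments.
  set ρ : ℂ[X] →ₗ[ℂ] ℂ := resInfty ∘ₗ mulOp (a * a * polyIncl e) ∘ₗ polyIncl.toLinearMap with hρ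
  have hρa : ∀ f, ρ f = resInfty (a * a * polyIncl e * polyIncl f) := fun f => rfl
  have hmem : ∀ f, e * f ∈ clearDenom S N (AdelicGr.annih W) ↔
      ∀ v ∈ clearDenom S N W, ρ (f * v) = 0 := by
    intro f
    rw [mem_clearDenom]
    constructor
    · intro hf v hv
      rw [hρa, ← hf _ hv]
      congr 1
      change _ = a * polyIncl (e * f) * (a * polyIncl v)
      simp only [map_mul]
      ring
    · intro hf g hg
      obtain ⟨v, hv, rfl⟩ := h.exists_clearDenom hg
      rw [← hf v hv, hρa]
      congr 1
      simp only [map_mul, ← ha]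
      ring
  have h0 : ∀ g, ρ ((X - C l) ^ (2 * N) * g) = 0 := by
    intro g
    obtain ⟨r, hr⟩ := ptsPoly_pow_dvd_mul_idempotent h2
    rw [hρa, mul_assoc, ← map_mul,
      show e * ((X - C l) ^ (2 * N) * g) = ptsPoly S ^ (2 * N) * (r * g) by
        linear_combination g * hr, haP]
    exact resInfty_polyIncl _
  -- The local spaces of `W` and `W*` are orthogonal for `ρ`, so their codimensions add up to `2N`;
  -- that of `W` is `N`.
  have hsum := finrank_quotient_orthogonal (l := l) (M := 2 * N) ρ h0 (fun f hf => ?_)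
    (V := clearDenom S N W ⊔ multiples ((X - C l) ^ (2 * N)))
    (V' := clearDenom S N (AdelicGr.annih W) ⊔ multiples ((X - C l) ^ (2 * N))) le_sup_right
    (fun f => ?_)
  · rw [h.codim l hl] at hsum
    omega
  -- Non-degeneracy: if `f` is orthogonal to everything, then `e f / P^(2N)` is a polynomial, and `e
  -- ≡ 1` at `l`.
  · obtain ⟨r, hr⟩ := mem_range_of_resInfty (f := a * a * polyIncl (e * f)) fun g => by
      rw [← hf g, hρa]
      congr 1
      simp only [map_mul]
      ring
    have h3 : e * f = ptsPoly S ^ (2 * N) * r := by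
      apply RatFunc.algebraMap_injective ℂ
      change polyIncl _ = polyIncl _
      rw [map_mul _ _ r, hr, two_mul, pow_add, map_mul _ (ptsPoly S ^ N), ha]
      field_simp
    have h4 : (X - C l) ^ (2 * N) ∣ e * f := by
      rw [h3]
      exact (pow_dvd_pow_of_dvd (X_sub_C_dvd_ptsPoly hl) _).mul_right r
    rw [show f = e * f - (e - 1) * f by ring]
    exact dvd_sub h4 (h1.mul_right f)
  · constructor
    · intro hf v hv
      obtain ⟨u, hu, g, hg, rfl⟩ := Submodule.mem_sup.mp hv
      obtain ⟨r, rfl⟩ := mem_multiples.mp hg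
      obtain ⟨x, hx, y, hy, rfl⟩ := Submodule.mem_sup.mp hf
      obtain ⟨s, rfl⟩ := mem_multiples.mp hy
      have hx' : e * x ∈ clearDenom S N (AdelicGr.annih W) := by
        have h5 := hst e (locConst_idempotent h1 h2) _ hx
        rw [mem_clearDenom, map_mul]
        convert! h5 using 1
        change _ = _ * (_ * polyIncl x)
        ring
      rw [show (x + (X - C l) ^ (2 * N) * s) * (u + (X - C l) ^ (2 * N) * r) = x * u +
        (X - C l) ^ (2 * N) * (x * r + s * (u + (X - C l) ^ (2 * N) * r)) by ring, map_add, h0,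
        (hmem x).mp hx' u hu, add_zero]
    · intro hf
      rw [show f = e * f + (-(e - 1) * f) by ring]
      refine Submodule.add_mem_sup ((hmem f).mpr fun v hv => hf v (Submodule.mem_sup_left hv))
        (mem_multiples.mpr ((dvd_neg.mpr h1).mul_right f))

end NormalAt

/-! ### Normal form of the points of the adelic Grassmannian -/

lemma IsPrimary.mono {l : ℂ} {V : Submodule ℂ ℂ[X]} {r N : ℕ} (h : ∀ p, (X - C l) ^ r * p ∈ V)
    (hN : r ≤ N) : multiples ((X - C l) ^ N) ≤ V := by
  intro f hf
  obtain ⟨g, rfl⟩ := (pow_dvd_pow _ hN).trans (mem_multiples.mp hf)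
  exact h g

/-- The space `m⁻¹ ⋂ V_l` attached to primary spaces `V_l`, where `m = ∏ (z - l)^(codim V_l)`. -/
def grSpace (S : Finset ℂ) (V : ℂ → Submodule ℂ ℂ[X]) : Submodule ℂ Kz :=
  ((⨅ l ∈ S, V l).map polyIncl.toLinearMap).map (mulOp (polyIncl (adPoly S V))⁻¹)

lemma mem_iInf_of_forall {S : Finset ℂ} {V : ℂ → Submodule ℂ ℂ[X]} {v : ℂ[X]}
    (h : ∀ l ∈ S, v ∈ V l) : v ∈ ⨅ l ∈ S, V l :=
  (Submodule.mem_iInf _).mpr fun l => (Submodule.mem_iInf _).mpr fun hl => h l hl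

lemma mem_of_mem_iInf {S : Finset ℂ} {V : ℂ → Submodule ℂ ℂ[X]} {v : ℂ[X]}
    (h : v ∈ ⨅ l ∈ S, V l) {l : ℂ} (hl : l ∈ S) : v ∈ V l :=
  (Submodule.mem_iInf _).mp ((Submodule.mem_iInf _).mp h l) hl

/-- Writing `P^N = q m`, the cleared space is `q ⋂ V_l`. At `l` the factor `q` has order `N - codim
V_l`, which raises the codimension to `N`. -/
lemma normalAt_grSpace {S : Finset ℂ} {V : ℂ → Submodule ℂ ℂ[X]} {N : ℕ}
    (hV : ∀ l ∈ S, multiples ((X - C l) ^ N) ≤ V l)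
    (hk : ∀ l ∈ S, Module.finrank ℂ (ℂ[X] ⧸ V l) ≤ N) : NormalAt S N (grSpace S V) := by
  set m := adPoly S V with hm
  set q : ℂ[X] := ∏ l ∈ S, (X - C l) ^ (N - Module.finrank ℂ (ℂ[X] ⧸ V l)) with hq
  have hqm : q * m = ptsPoly S ^ N := by
    rw [hq, hm, adPoly, ptsPoly, ← Finset.prod_mul_distrib, ← Finset.prod_pow]
    refine Finset.prod_congr rfl fun l hl => ?_
    rw [← pow_add, Nat.sub_add_cancel (hk l hl)]
  have hP0 : q * m ≠ 0 := hqm ▸ pow_ne_zero _ (ptsPoly_ne_zero S)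
  have hm0 : polyIncl m ≠ 0 := polyIncl_ne_zero (right_ne_zero_of_mul hP0)
  have hq0 : polyIncl q ≠ 0 := polyIncl_ne_zero (left_ne_zero_of_mul hP0)
  have hmem : ∀ f, f ∈ grSpace S V ↔ ∃ v ∈ ⨅ l ∈ S, V l, f = (polyIncl m)⁻¹ * polyIncl v := by
    intro f
    constructor
    · rintro ⟨_, ⟨v, hv, rfl⟩, rfl⟩
      exact ⟨v, hv, rfl⟩
    · rintro ⟨v, hv, rfl⟩
      exact ⟨_, ⟨v, hv, rfl⟩, rfl⟩
  have hclear : clearDenom S N (grSpace S V) = (⨅ l ∈ S, V l).map (LinearMap.mulLeft ℂ q) := by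
    ext p
    rw [mem_clearDenom, hmem, ← hqm]
    constructor
    · rintro ⟨v, hv, h⟩
      refine ⟨v, hv, RatFunc.algebraMap_injective ℂ ?_⟩
      change polyIncl (q * v) = polyIncl p
      rw [map_mul] at h ⊢
      field_simp at h
      rw [← h]
    · rintro ⟨v, hv, rfl⟩
      refine ⟨v, hv, ?_⟩
      rw [LinearMap.mulLeft_apply, map_mul, map_mul]
      field_simp
  refine ⟨fun f hf => ?_, fun p => ?_, fun e he f hf => ?_, fun l hl => ?_⟩
  · obtain ⟨v, -, rfl⟩ := (hmem f).mp hf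
    refine ⟨q * v, ?_⟩
    rw [← hqm, map_mul, map_mul]
    field_simp
  · refine (hmem _).mpr ⟨m * (ptsPoly S ^ N * p), mem_iInf_of_forall fun l hl => ?_, ?_⟩
    · exact hV l hl (mem_multiples.mpr (((pow_dvd_pow_of_dvd (X_sub_C_dvd_ptsPoly hl) _).mul_right
        p).mul_left m))
    · rw [map_mul _ m, inv_mul_cancel_left₀ hm0]
  · obtain ⟨v, hv, rfl⟩ := (hmem f).mp hf
    refine (hmem _).mpr ⟨e * v, mem_iInf_of_forall fun l hl => ?_, ?_⟩
    · obtain ⟨a, ha⟩ := he l hl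
      rw [show e * v = a • v + (e - C a) * v by rw [smul_eq_C_mul]; ring]
      refine add_mem (Submodule.smul_mem _ _ (mem_of_mem_iInf hv hl)) (hV l hl (mem_multiples.mpr ?_))
      exact ((pow_dvd_pow _ (by omega)).trans ha).mul_right v
    · rw [map_mul]; ring
  · have hcod := finrank_quotient_mul (l := l) (j := N - Module.finrank ℂ (ℂ[X] ⧸ V l)) (r := N)
      (M := 2 * N) (V := V l)
      (u := ∏ m ∈ S.erase l, (X - C m) ^ (N - Module.finrank ℂ (ℂ[X] ⧸ V m)))
      (IsCoprime.prod_right fun m hm =>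
        (isCoprime_X_sub_C (Finset.ne_of_mem_erase hm).symm).pow_right) (hV l hl) (by omega)
    rw [Finset.mul_prod_erase S (fun m => (X - C m) ^ (N - Module.finrank ℂ (ℂ[X] ⧸ V m))) hl,
      ← hq, Nat.add_sub_cancel' (hk l hl)] at hcod
    -- Only `V l` matters near `l`: the idempotent moves any `v ∈ V l` into all the other primary
    -- spaces.
    have heq : clearDenom S N (grSpace S V) ⊔ multiples ((X - C l) ^ (2 * N)) =
        (V l).map (LinearMap.mulLeft ℂ q) ⊔ multiples ((X - C l) ^ (2 * N)) := by
      rw [hclear]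
      refine le_antisymm (sup_le_sup_right (Submodule.map_mono (iInf₂_le l hl)) _)
        (sup_le ?_ le_sup_right)
      rintro _ ⟨v, hv, rfl⟩
      obtain ⟨e, h1, h2⟩ := exists_idempotent (S := S) (l := l) (2 * N)
      rw [LinearMap.mulLeft_apply, show q * v = q * (e * v) + -(e - 1) * (q * v) by ring]
      refine Submodule.add_mem_sup ⟨e * v, mem_iInf_of_forall fun m hm => ?_, rfl⟩
        (mem_multiples.mpr ((dvd_neg.mpr h1).mul_right _))
      by_cases hml : m = l
      · subst hml
        rw [show e * v = v + (e - 1) * v by ring]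
        exact add_mem hv (hV m hm (mem_multiples.mpr
          (((pow_dvd_pow _ (by omega)).trans h1).mul_right v)))
      · exact hV m hm (mem_multiples.mpr (((pow_dvd_pow _ (by omega)).trans (h2 m hm hml)).mul_right v))
    rw [heq, hcod]

/-- A point of the adelic Grassmannian is in normal form for all sufficiently large sets of points
and orders. -/
lemma exists_normalAt {W : Submodule ℂ Kz} (hW : W ∈ Gr) :
    ∃ (S₀ : Finset ℂ) (N₀ : ℕ), ∀ S N, S₀ ⊆ S → N₀ ≤ N → NormalAt S N W := by
  classical
  obtain ⟨s, V, hV, rfl⟩ := hW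
  choose! r hr using hV
  -- The sum bounds both the exponent and the codimension.
  refine ⟨s, s.sup fun l => r l + Module.finrank ℂ (ℂ[X] ⧸ V l), fun S N hS hN => ?_⟩
  have hN' : ∀ l ∈ s, r l + Module.finrank ℂ (ℂ[X] ⧸ V l) ≤ N := fun l hl =>
    (Finset.le_sup (f := fun l => r l + Module.finrank ℂ (ℂ[X] ⧸ V l)) hl).trans hN
  -- At additional points the whole of `ℂ[z]` is used, which changes neither the intersection nor
  -- the denominator.
  set V' : ℂ → Submodule ℂ ℂ[X] := fun l => if l ∈ s then V l else ⊤ with hV'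
  have hin : ∀ l ∈ s, V' l = V l := fun l hl => if_pos hl
  have hout : ∀ l ∉ s, V' l = ⊤ := fun l hl => if_neg hl
  have hdim : ∀ l ∉ s, Module.finrank ℂ (ℂ[X] ⧸ V' l) = 0 := fun l hl => by
    rw [hout l hl]
    exact Module.finrank_zero_of_subsingleton
  have hpoly : adPoly S V' = adPoly s V := by
    rw [adPoly, ← Finset.prod_subset hS fun l _ hl => by rw [hdim l hl, pow_zero]]
    exact Finset.prod_congr rfl fun l hl => by rw [hin l hl]
  have hinf : ⨅ l ∈ S, V' l = ⨅ l ∈ s, V l := by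
    refine le_antisymm (le_iInf₂ fun l hl => (iInf₂_le l (hS hl)).trans (hin l hl).le)
      (le_iInf₂ fun l _ => ?_)
    by_cases h : l ∈ s
    · exact (iInf₂_le l h).trans (hin l h).ge
    · rw [hout l h]
      exact le_top
  have key := normalAt_grSpace (S := S) (V := V') (N := N) (fun l _ => ?_) (fun l _ => ?_)
  · rwa [grSpace, hpoly, hinf] at key
  · by_cases h : l ∈ s
    · rw [hin l h]
      exact IsPrimary.mono (hr l h) (by have := hN' l h; omega)
    · rw [hout l h]
      exact le_top
  · by_cases h : l ∈ s
    · rw [hin l h]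
      have := hN' l h
      omega
    · rw [hdim l h]
      exact Nat.zero_le _

/-! ### Recovering `W` from `R_W` -/

namespace NormalAt

variable {S : Finset ℂ} {N : ℕ} {W : Submodule ℂ Kz}

/-- `W` is spanned by `R_W.ℂ[z]`. -/
lemma le_of_forall_act_mem (h : NormalAt S N W) {Z : Submodule ℂ Kz}
    (hZ : ∀ P : DOp, (∀ p, P.act (polyIncl p) ∈ W) → ∀ p, P.act (polyIncl p) ∈ Z) : W ≤ Z := by
  intro f hf
  choose e h1 h2 using fun l => exists_idempotent (S := S) (l := l) (2 * N)
  obtain ⟨g, hg⟩ := ptsPoly_pow_dvd_sum_sub_one h1 h2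
  obtain ⟨p, hp⟩ := h.le f hf
  have hmul : ∀ r : ℂ[X], polyIncl (ptsPoly S ^ (2 * N) * r) * f =
      polyIncl (ptsPoly S ^ N * (r * p)) := by
    intro r
    simp only [map_mul, ← hp, two_mul, pow_add]
    ring
  have h3 : f = ∑ l ∈ S, polyIncl (e l) * f - polyIncl (ptsPoly S ^ (2 * N) * g) * f := by
    rw [← Finset.sum_mul, ← map_sum, ← sub_mul, ← map_sub, ← hg]
    simp
  rw [h3, hmul]
  refine sub_mem (sum_mem fun l _ => ?_) ?_
  -- Composing `P` with multiplication by `e l * f` gives an operator with value `e l * f` at `1`.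
  -- It lies in `R_W`, because its other values are scalar multiples of `e l * f` modulo `(∏ (z -
  -- l))^N ℂ[z]`.
  · obtain ⟨P, hP1, hP⟩ := exists_constant_mod_pow l (2 * N)
    have h4 := hZ (fnD (polyIncl (e l) * f) * P) (fun r => ?_) 1
    · rw [DOp.act_mul, map_one, hP1] at h4
      change polyIncl (e l) * f * 1 ∈ Z at h4
      rwa [mul_one] at h4
    · obtain ⟨a, v, hv⟩ := hP r
      obtain ⟨u, hu⟩ := ptsPoly_pow_dvd_mul_idempotent (h2 l)
      rw [DOp.act_mul, hv]
      change polyIncl (e l) * f * polyIncl _ ∈ W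
      have h5 : polyIncl (e l) * f * polyIncl (C a + (X - C l) ^ (2 * N) * v) =
          a • (polyIncl (e l) * f) + polyIncl (ptsPoly S ^ (2 * N) * (u * v)) * f := by
        rw [← mul_assoc (ptsPoly S ^ (2 * N)), ← hu, ← smul_mul_assoc, ← map_smul,
          smul_eq_C_mul]
        simp only [map_mul, map_add]
        ring
      rw [h5, hmul]
      exact add_mem (W.smul_mem _ (h.stable _ (locConst_idempotent (h1 l) (h2 l)) f hf)) (h.ge _)
  -- The remainder is a value of multiplication by `ptsPoly S ^ N`, an element of `R_W`.
  · have h4 := hZ (fnD (polyIncl (ptsPoly S ^ N))) (fun r => ?_) (g * p)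
    · change polyIncl _ * polyIncl _ ∈ Z at h4
      rwa [← map_mul] at h4
    · change polyIncl _ * polyIncl _ ∈ W
      rw [← map_mul]
      exact h.ge r

lemma ptsPoly_mem_rIdeal (h : NormalAt S N W) :
    inclQ (fnD (polyIncl (ptsPoly S ^ N))) ∈ rIdeal W := by
  refine ⟨_, fun r => ?_, rfl⟩
  change polyIncl _ * polyIncl _ ∈ W
  rw [← map_mul]
  exact h.ge r

lemma rIdeal_ne_bot (h : NormalAt S N W) : rIdeal W ≠ ⊥ := by
  refine (Submodule.ne_bot_iff _).mpr ⟨_, h.ptsPoly_mem_rIdeal, ?_⟩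
  rw [Ne, map_eq_zero_iff _ inclQ_injective]
  exact fnD_ne_zero (polyIncl_ptsPoly_pow_ne_zero S N)

/-- `R_W` is isomorphic to a non-zero right ideal of `A₁`. -/
lemma exists_rightIdeal (h : NormalAt S N W) :
    ∃ I, IsNonzeroRightIdeal I ∧ Nonempty (I ≃ₗ[weyl.op] rIdeal W) := by
  set q := inclQ (fnD (polyIncl (ptsPoly S ^ N))) with hq
  have hq0 : q ≠ 0 := by
    rw [hq, Ne, map_eq_zero_iff _ inclQ_injective]
    exact fnD_ne_zero (polyIncl_ptsPoly_pow_ne_zero S N)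
  obtain ⟨e⟩ := nonempty_equiv_map_lmulQ (rIdeal W) hq0
  refine ⟨(rIdeal W).map (lmulQ q), ⟨?_, ?_⟩, ⟨e.symm⟩⟩
  · refine (Submodule.ne_bot_iff _).mpr ⟨_, ⟨_, h.ptsPoly_mem_rIdeal, rfl⟩, mul_ne_zero hq0 hq0⟩
  · rintro _ ⟨_, ⟨P, hP, rfl⟩, rfl⟩
    rw [lmulQ_apply, hq, ← map_mul]
    refine mem_weyl_of_preserves fun r => ?_
    obtain ⟨p, hp⟩ := h.le _ (hP r)
    exact ⟨p, hp.symm⟩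

/-- The dual of `c(R_W)` is `c(L_W)`. -/
lemma dualRight_cRight_rIdeal (h : NormalAt S N W) :
    dualRight (cRight (rIdeal W)) = cLeft (lIdeal W) := by
  ext x
  constructor
  · intro hx
    refine ⟨c x, ?_, c_c x⟩
    have hr : ∀ r ∈ rIdeal W, c x * r ∈ weyl := by
      intro r hr
      have h1 := c_mem_weyl (hx (c r) ⟨r, hr, rfl⟩)
      rwa [c_mul, c_c] at h1
    -- `R_W` contains a non-zero function, so `c x` is a differential operator; it is then enough to
    -- test it on `R_W.ℂ[z]`.
    obtain ⟨A, hA, -⟩ := weyl_preserves_poly (hr _ h.ptsPoly_mem_rIdeal)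
    obtain ⟨R, hR⟩ := mem_range_inclQ_of_mul (polyIncl_ptsPoly_pow_ne_zero S N) hA.symm
    rw [hR] at hr ⊢
    refine ⟨R, ?_, rfl⟩
    refine h.le_of_forall_act_mem
      (Z := (Subalgebra.toSubmodule polyIncl.range).comap R.act) fun P hP p => ?_
    obtain ⟨A, hA, hA'⟩ := weyl_preserves_poly (hr _ ⟨P, hP, rfl⟩)
    rw [← map_mul] at hA
    rw [inclQ_injective hA] at hA'
    obtain ⟨r, hr⟩ := hA' p
    exact ⟨r, hr.symm⟩
  · rintro ⟨_, ⟨R, hR, rfl⟩, rfl⟩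
    rintro _ ⟨_, ⟨P, hP, rfl⟩, rfl⟩
    rw [← c_mul, ← map_mul]
    exact c_mem_weyl (mem_weyl_of_preserves fun r => hR _ (hP r))

end NormalAt

/-! ### Injectivity of `α` -/

/-- If `R_U` and `R_W` are isomorphic, then `U = g W` for a rational function `g`. -/
lemma exists_mul_eq_of_equiv {S : Finset ℂ} {N : ℕ} {U W : Submodule ℂ Kz} (hU : NormalAt S N U)
    (hW : NormalAt S N W) (e : Nonempty (rIdeal W ≃ₗ[weyl.op] rIdeal U)) :
    ∃ g : Kz, g ≠ 0 ∧ U = W.map (mulOp g) := by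
  obtain ⟨e⟩ := e
  obtain ⟨q, hq, hUW⟩ := exists_eq_map_lmulQ hW.rIdeal_ne_bot e
  have hmul : ∀ x, x ∈ rIdeal W → q * x ∈ rIdeal U := fun x hx => hUW ▸ ⟨x, hx, rfl⟩
  have hinv : ∀ x, x ∈ rIdeal U → q⁻¹ * x ∈ rIdeal W := by
    intro x hx
    rw [hUW] at hx
    obtain ⟨y, hy, rfl⟩ := hx
    rwa [lmulQ_apply, inv_mul_cancel_left₀ hq]
  obtain ⟨A, -, hA⟩ := hmul _ hW.ptsPoly_mem_rIdeal
  obtain ⟨B, -, hB⟩ := hinv _ hU.ptsPoly_mem_rIdeal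
  -- Both `q` and `q⁻¹` multiply a non-zero function into `ℂ(z)[∂]`, so `q` is a unit there.
  obtain ⟨P, rfl⟩ := mem_range_inclQ_of_mul (polyIncl_ptsPoly_pow_ne_zero S N) hA.symm
  obtain ⟨R, hR⟩ := mem_range_inclQ_of_mul (polyIncl_ptsPoly_pow_ne_zero S N) hB.symm
  have hPR : P * R = 1 := by
    apply inclQ_injective
    rw [map_mul, ← hR, mul_inv_cancel₀ hq, map_one]
  obtain ⟨g, rfl⟩ := exists_fnD_of_mul_eq_one hPR
  have hg : g ≠ 0 := by
    rintro rfl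
    exact hq (by rw [show fnD 0 = 0 from DOp.act_injective (map_zero mulOp), map_zero])
  refine ⟨g, hg, le_antisymm (hU.le_of_forall_act_mem fun D hD p => ?_) ?_⟩
  · have h1 := hinv _ ⟨D, hD, rfl⟩
    rw [inclQ_fnD_inv g hg, ← map_mul] at h1
    obtain ⟨E, hE, hE'⟩ := h1
    rw [inclQ_injective hE'] at hE
    exact ⟨_, hE p, mul_inv_cancel_left₀ hg _⟩
  · rw [Submodule.map_le_iff_le_comap]
    refine hW.le_of_forall_act_mem fun D hD p => ?_
    have h1 := hmul _ ⟨D, hD, rfl⟩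
    rw [← map_mul] at h1
    obtain ⟨E, hE, hE'⟩ := h1
    rw [inclQ_injective hE'] at hE
    exact hE p

/-- The local codimension detects the order of the factor `q` at `l`. This is how the normalization
in `Gr` rigidifies `W` against rational factors. -/
lemma NormalAt.finrank_quotient_mul {S : Finset ℂ} {N : ℕ} {W : Submodule ℂ Kz}
    (h : NormalAt S N W) {l : ℂ} (hl : l ∈ S) {q : ℂ[X]} (hq : q ≠ 0) {M : ℕ}
    (hM : 2 * N + q.rootMultiplicity l ≤ M) :
    Module.finrank ℂ (ℂ[X] ⧸ ((clearDenom S N W).map (LinearMap.mulLeft ℂ q) ⊔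
      multiples ((X - C l) ^ M))) = N + q.rootMultiplicity l := by
  obtain ⟨u, hu, hnd⟩ := exists_eq_pow_rootMultiplicity_mul_and_not_dvd q hq l
  have hcop : IsCoprime (X - C l) u := (irreducible_X_sub_C l).coprime_iff_not_dvd.mpr hnd
  have key := AdelicGr.finrank_quotient_mul (V := clearDenom S N W ⊔ multiples ((X - C l) ^ (2 * N)))
    hcop le_sup_right hM
  rw [← hu, h.codim l hl] at key
  suffices heq : (clearDenom S N W).map (LinearMap.mulLeft ℂ q) ⊔ multiples ((X - C l) ^ M) =
      (clearDenom S N W ⊔ multiples ((X - C l) ^ (2 * N))).map (LinearMap.mulLeft ℂ q) ⊔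
        multiples ((X - C l) ^ M) by rw [heq, key]
  rw [Submodule.map_sup]
  refine le_antisymm (sup_le_sup_right le_sup_left _) (sup_le (sup_le le_sup_left ?_) le_sup_right)
  rintro _ ⟨_, hf, rfl⟩
  obtain ⟨g, rfl⟩ := mem_multiples.mp hf
  -- Order `M ≥ 2N` is needed: the error `e - 1` must be absorbed modulo `(z - l)^M`.
  obtain ⟨e, h1, h2⟩ := exists_idempotent (S := S) (l := l) M
  rw [LinearMap.mulLeft_apply, show q * ((X - C l) ^ (2 * N) * g) =
    q * (e * ((X - C l) ^ (2 * N) * g)) + -(e - 1) * (q * ((X - C l) ^ (2 * N) * g)) by ring]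
  refine Submodule.add_mem_sup ⟨_, h.mem_clearDenom_of_dvd (ptsPoly_pow_dvd fun m hm => ?_), rfl⟩
    (mem_multiples.mpr ((dvd_neg.mpr h1).mul_right _))
  by_cases hml : m = l
  · rw [hml]
    exact (dvd_mul_right _ _).mul_left _
  · exact ((pow_dvd_pow _ (by omega)).trans (h2 m hm hml)).mul_right _

lemma exists_eq_C_of_forall_not_isRoot {p : ℂ[X]} (hp : ∀ l, ¬ p.IsRoot l) : ∃ a, p = C a := by
  refine ⟨p.coeff 0, eq_C_of_degree_le_zero ?_⟩
  by_contra h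
  obtain ⟨l, hl⟩ := IsAlgClosed.exists_root p (fun h0 => h h0.le)
  exact hp l hl

/-- Two points of the adelic Grassmannian that differ by a rational factor coincide. -/
lemma eq_of_eq_map_mulOp {U W : Submodule ℂ Kz} (hU : U ∈ Gr) (hW : W ∈ Gr) {g : Kz} (hg : g ≠ 0)
    (h : U = W.map (mulOp g)) : U = W := by
  classical
  obtain ⟨S₁, N₁, h₁⟩ := exists_normalAt hU
  obtain ⟨S₂, N₂, h₂⟩ := exists_normalAt hW
  set a := g.num with ha
  set b := g.denom with hb
  have ha0 : a ≠ 0 := RatFunc.num_ne_zero hg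
  have hb0 : b ≠ 0 := g.denom_ne_zero
  have hab : IsCoprime a b := g.isCoprime_num_denom
  have hgab : polyIncl b * g = polyIncl a := by
    have h2 := num_div g
    rw [div_eq_iff (polyIncl_ne_zero g.denom_ne_zero)] at h2
    rw [ha, h2, mul_comm]
  -- All zeros and poles of `g` are included, so that its order can be compared at each of them.
  set S := S₁ ∪ S₂ ∪ a.roots.toFinset ∪ b.roots.toFinset with hS
  set N := max N₁ N₂ with hN
  have hUn : NormalAt S N U := h₁ S N (fun x hx => by simp [hS, hx]) (le_max_left _ _)
  have hWn : NormalAt S N W := h₂ S N (fun x hx => by simp [hS, hx]) (le_max_right _ _)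
  have hP := polyIncl_ptsPoly_pow_ne_zero S N
  have hclear : (clearDenom S N W).map (LinearMap.mulLeft ℂ a) =
      (clearDenom S N U).map (LinearMap.mulLeft ℂ b) := by
    ext p
    constructor
    · rintro ⟨w, hw, rfl⟩
      have h3 : g * ((polyIncl (ptsPoly S ^ N))⁻¹ * polyIncl w) ∈ U := h ▸ ⟨_, hw, rfl⟩
      obtain ⟨u, hu, hu'⟩ := hUn.exists_clearDenom h3
      refine ⟨u, hu, RatFunc.algebraMap_injective ℂ ?_⟩
      change polyIncl (b * u) = polyIncl (a * w)
      field_simp at hu'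
      rw [map_mul, map_mul, ← hu', ← hgab, mul_assoc]
    · rintro ⟨u, hu, rfl⟩
      have h3 : (polyIncl (ptsPoly S ^ N))⁻¹ * polyIncl u ∈ W.map (mulOp g) := h ▸ hu
      obtain ⟨f, hf, hfu⟩ := h3
      obtain ⟨w, hw, rfl⟩ := hWn.exists_clearDenom hf
      refine ⟨w, hw, RatFunc.algebraMap_injective ℂ ?_⟩
      change polyIncl (a * w) = polyIncl (b * u)
      change g * ((polyIncl (ptsPoly S ^ N))⁻¹ * polyIncl w) = _ at hfu
      field_simp at hfu
      rw [map_mul, map_mul, ← hfu, ← hgab, mul_assoc]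
  -- The equal spaces `a P^N W` and `b P^N U` have local codimensions `N + ord a` and `N + ord b`.
  have hmult : ∀ l ∈ S, a.rootMultiplicity l = b.rootMultiplicity l := by
    intro l hl
    have h3 := hWn.finrank_quotient_mul hl ha0
      (M := 2 * N + a.rootMultiplicity l + b.rootMultiplicity l) (by omega)
    have h4 := hUn.finrank_quotient_mul hl hb0
      (M := 2 * N + a.rootMultiplicity l + b.rootMultiplicity l) (by omega)
    rw [hclear, h4] at h3
    omega
  have hcop : ∀ l, a.IsRoot l → b.IsRoot l → False := fun l hal hbl =>
    (irreducible_X_sub_C l).not_isUnit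
      (hab.isUnit_of_dvd' (dvd_iff_isRoot.mpr hal) (dvd_iff_isRoot.mpr hbl))
  have hroot : ∀ l ∈ S, (a.IsRoot l ↔ b.IsRoot l) := fun l hl => by
    rw [← rootMultiplicity_pos ha0, ← rootMultiplicity_pos hb0, hmult l hl]
  -- Coprime polynomials with the same roots have none, so they are constant over `ℂ`.
  obtain ⟨α, hα⟩ := exists_eq_C_of_forall_not_isRoot (p := a) fun l hl =>
    hcop l hl ((hroot l (by simp [hS, hl.eq_zero, ha0])).mp hl)
  obtain ⟨β, hβ⟩ := exists_eq_C_of_forall_not_isRoot (p := b) fun l hl =>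
    hcop l ((hroot l (by simp [hS, hl.eq_zero, hb0])).mpr hl) hl
  have hβ0 : β ≠ 0 := by
    rintro rfl
    exact hb0 (by rw [hβ, C_0])
  have hα0 : α ≠ 0 := by
    rintro rfl
    exact ha0 (by rw [hα, C_0])
  have hgc : ∀ f : Kz, g * f = (β⁻¹ * α) • f := by
    have hC : ∀ x : ℂ, polyIncl (C x) = algebraMap ℂ Kz x := fun x => polyIncl.commutes x
    rw [hα, hβ, hC, hC] at hgab
    intro f
    rw [Algebra.smul_def, map_mul, ← hgab, ← mul_assoc (algebraMap ℂ Kz β⁻¹), ← map_mul,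
      inv_mul_cancel₀ hβ0, map_one, one_mul]
  rw [h]
  ext f
  constructor
  · rintro ⟨w, hw, rfl⟩
    change g * w ∈ W
    rw [hgc]
    exact W.smul_mem _ hw
  · intro hf
    refine ⟨(β⁻¹ * α)⁻¹ • f, W.smul_mem _ hf, ?_⟩
    change g * _ = f
    rw [hgc, smul_smul, mul_inv_cancel₀ (mul_ne_zero (inv_ne_zero hβ0) hα0), one_smul]

/-! ### The map `α` and the action of `c` -/

lemma alpha_nonempty {W : Submodule ℂ Kz} (hW : W ∈ Gr) : (alpha W).Nonempty := by
  obtain ⟨S, N, h⟩ := exists_normalAt hW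
  obtain ⟨I, hI, e⟩ := (h S N subset_rfl le_rfl).exists_rightIdeal
  exact ⟨I, hI, e⟩

lemma alpha_mem_isoClasses {W : Submodule ℂ Kz} (hW : W ∈ Gr) : alpha W ∈ isoClasses := by
  obtain ⟨I, hI, ⟨e⟩⟩ := alpha_nonempty hW
  exact ⟨I, hI, isoClass_congr ⟨e.symm⟩⟩

lemma annih_mem_Gr {W : Submodule ℂ Kz} (hW : W ∈ Gr) : annih W ∈ Gr := by
  obtain ⟨S, N, h⟩ := exists_normalAt hW
  exact (h S N subset_rfl le_rfl).annih.mem_Gr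

/-- The dual of `c(R_W)` is `c(L_W)`, which is `R_{W*}`. -/
lemma cStar_alpha {W : Submodule ℂ Kz} (hW : W ∈ Gr) : cStar (alpha W) = alpha (annih W) := by
  obtain ⟨S, N, h⟩ := exists_normalAt hW
  rw [alpha, cStar_isoClass (alpha_nonempty hW),
    (h S N subset_rfl le_rfl).dualRight_cRight_rIdeal, alpha, rIdeal_annih]

/-- The map `α` is injective on the adelic Grassmannian. -/
lemma alpha_injOn : Set.InjOn alpha Gr := by
  classical
  intro U hU W hW h
  obtain ⟨S₁, N₁, h₁⟩ := exists_normalAt hU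
  obtain ⟨S₂, N₂, h₂⟩ := exists_normalAt hW
  obtain ⟨I, hI⟩ := alpha_nonempty hU
  have hI' : I ∈ alpha W := h ▸ hI
  obtain ⟨-, ⟨e₁⟩⟩ := hI
  obtain ⟨-, ⟨e₂⟩⟩ := hI'
  obtain ⟨g, hg, hUW⟩ := exists_mul_eq_of_equiv
    (h₁ (S₁ ∪ S₂) (max N₁ N₂) Finset.subset_union_left (le_max_left _ _))
    (h₂ (S₁ ∪ S₂) (max N₁ N₂) Finset.subset_union_right (le_max_right _ _)) ⟨e₂.symm.trans e₁⟩
  exact eq_of_eq_map_mulOp hU hW hg hUW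

end AdelicGr

end

theorem mainTheorem6 (W : Submodule ℂ AdelicGr.Kz) (hW : W ∈ AdelicGr.Gr) :
    AdelicGr.annih W ∈ AdelicGr.Gr ∧
    AdelicGr.rIdeal (AdelicGr.annih W) = AdelicGr.cLeft (AdelicGr.lIdeal W) ∧
    AdelicGr.alpha W ∈ AdelicGr.isoClasses ∧
    ∀ U ∈ AdelicGr.Gr,
      AdelicGr.alpha U = AdelicGr.cStar (AdelicGr.alpha W) ↔ U = AdelicGr.annih W := by
  have hW' := AdelicGr.annih_mem_Gr hW
  refine ⟨hW', AdelicGr.rIdeal_annih W, AdelicGr.alpha_mem_isoClasses hW, fun U hU => ?_⟩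
  rw [AdelicGr.cStar_alpha hW]
  exact AdelicGr.alpha_injOn.eq_iff hU hW'
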